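/- Let $n$ be a natural number and let $\Omega$ be a compact smooth $(n+1)$-dimensional manifold with corners whose boundary is $\partial\Omega=Y\cup\Sigma_0\cup\Sigma_1$, where $\Sigma_0\cap\Sigma_1=\emptyset$, where $Y,\Sigma_0,\Sigma_1$ are $n$-dimensional manifolds with boundary, and where the corners of $\Omega$ are exactly the non-empty sets $M_0=Y\cap\Sigma_0=\partial\Sigma_0$ and $M_1=Y\cap\Sigma_1=\partial\Sigma_1$, near which $\Omega$ is modelled on $\mathbb R_{\ge0}^2\times\mathbb R^{n-1}$ with $Y$ and $\Sigma_i$ the two faces; that is, $(\Omega,Y)$ is a cobordism between the manifolds with boundary $(\Sigma_0,M_0)$ and $(\Sigma_1,M_1)$. For a smooth Riemannian metric $g$ on $\Omega$, a Morse function on $(\Omega,Y)$ with respect to $g$ is a smooth function $F\colon\Omega\to[0,1]$ with $F|_{\Sigma_0}=0$ and $F|_{\Sigma_1}=1$, all of whose critical points are non-degenerate and lie outside $\Sigma_0\cup\Sigma_1$, and whose gradient $\nabla_gF$ is tangent to $Y$ at every point of $Y$. For a critical point $p$ of $F$ let $W^s_p$ (respectively $W^u_p$) be the set of points $x\in\Omega$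 whose trajectory under $\nabla_g F$ exists for all times $t\ge0$ (respectively $t\le 0$) and converges to $p$ as $t\to+\infty$ (respectively $t\to-\infty$), and put $K_p=W^s_p\cup\{p\}\cup W^u_p$. Let $g$ be a smooth Riemannian metric on $\Omega$, and let $F$ be a Morse function on $(\Omega,Y)$ with respect to $g$ whose critical points are exactly $p_1$ and $p_2$. Suppose that $K_{p_1}\cap K_{p_2}=\emptyset$, and let $a_1,a_2\in(0,1)$. Then there exist a smooth Riemannian metric $h$ on $\Omega$ and a Morse function $G\colon\Omega\to[0,1]$ on $(\Omega,Y)$ with respect to $h$ (in particular $\nabla_hG$ is everywhere tangent to $Y$) such that 1. the critical points of $G$ are exactly $p_1$ and $p_2$, and $G(p_i)=a_i$ for $i=1,2$; 2. for $i=1,2$ the difference $F-G$ is constant in a neighbourhood of $p_i$; 3. $h=g$ on an open neighbourhood of $K_{p_1}\cup K_{p_2}$; and if at least one of $p_1,p_2$ does not lie on $Y$, then $h=g$ on all of $\Omega$. -/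

import Mathlib

open Set Filter Topology Manifold
open scoped ContDiff

namespace CornerCobordism

/-- The model with corners `[0,∞)^(n+1) ⊆ ℝ^(n+1)` for `(n+1)`-dimensional manifolds with
corners. -/
noncomputable abbrev cornerModel (n : ℕ) :
    ModelWithCorners ℝ (EuclideanSpace ℝ (Fin (n + 1))) (EuclideanQuadrant (n + 1)) :=
  modelWithCornersEuclideanQuadrant (n + 1)

section Cobordism

variable {n : ℕ} {Ω : Type*} [TopologicalSpace Ω] [ChartedSpace (EuclideanQuadrant (n + 1)) Ω]

/-- `φ` is a smooth coordinate chart of `Ω` around `p`. -/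
def IsSmoothChartAt (φ : OpenPartialHomeomorph Ω (EuclideanQuadrant (n + 1))) (p : Ω) : Prop :=
  φ ∈ IsManifold.maximalAtlas (cornerModel n) ∞ Ω ∧ p ∈ φ.source

/-- In the chart `φ` the set `A` is the coordinate face `{x_a = 0}`. -/
def IsFaceIn (A : Set Ω) (φ : OpenPartialHomeomorph Ω (EuclideanQuadrant (n + 1)))
    (a : Fin (n + 1)) : Prop :=
  ∀ x ∈ φ.source, x ∈ A ↔ (φ x).1 a = 0

variable (n) in
/-- `(Ω, Y)` is a cobordism between the manifolds with boundary `(S₀, M₀)` and `(S₁, M₁)`, where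
`M₀ = Y ∩ S₀` and `M₁ = Y ∩ S₁`: the manifold with corners `Ω` is compact of dimension `n + 1`,
`∂Ω = Y ∪ S₀ ∪ S₁`, the sets `S₀`, `S₁` are disjoint, each of `Y`, `S₀`, `S₁` is a smooth
hypersurface with boundary, the corners of `Ω` (locally modelled on `ℝ_{≥0}² × ℝ^(n-1)`) are
exactly `M₀ ∪ M₁`, where `Y` meets `S₀`, respectively `S₁`, and `M₀ = ∂S₀`, `M₁ = ∂S₁` are
non-empty (hence so is `Y`). -/
structure IsCobordism (Y S₀ S₁ : Set Ω) : Prop where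
  compact : IsCompact (univ : Set Ω)
  closed_Y : IsClosed Y
  closed_S₀ : IsClosed S₀
  closed_S₁ : IsClosed S₁
  boundary_eq : (cornerModel n).boundary Ω = Y ∪ S₀ ∪ S₁
  disjoint : Disjoint S₀ S₁
  nonempty_M₀ : (Y ∩ S₀).Nonempty
  nonempty_M₁ : (Y ∩ S₁).Nonempty
  chart_Y : ∀ p ∈ Y \ (S₀ ∪ S₁), ∃ φ : OpenPartialHomeomorph Ω (EuclideanQuadrant (n + 1)),
    ∃ a, IsSmoothChartAt φ p ∧ IsFaceIn Y φ a ∧ (∀ x ∈ φ.source, ∀ b, b ≠ a → 0 < (φ x).1 b)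
  chart_S₀ : ∀ p ∈ S₀ \ Y, ∃ φ : OpenPartialHomeomorph Ω (EuclideanQuadrant (n + 1)),
    ∃ a, IsSmoothChartAt φ p ∧ IsFaceIn S₀ φ a ∧ (∀ x ∈ φ.source, ∀ b, b ≠ a → 0 < (φ x).1 b)
  chart_S₁ : ∀ p ∈ S₁ \ Y, ∃ φ : OpenPartialHomeomorph Ω (EuclideanQuadrant (n + 1)),
    ∃ a, IsSmoothChartAt φ p ∧ IsFaceIn S₁ φ a ∧ (∀ x ∈ φ.source, ∀ b, b ≠ a → 0 < (φ x).1 b)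
  chart_M₀ : ∀ p ∈ Y ∩ S₀, ∃ φ : OpenPartialHomeomorph Ω (EuclideanQuadrant (n + 1)),
    ∃ a b, a ≠ b ∧ IsSmoothChartAt φ p ∧ IsFaceIn Y φ a ∧ IsFaceIn S₀ φ b ∧
      (∀ x ∈ φ.source, ∀ c, c ≠ a → c ≠ b → 0 < (φ x).1 c)
  chart_M₁ : ∀ p ∈ Y ∩ S₁, ∃ φ : OpenPartialHomeomorph Ω (EuclideanQuadrant (n + 1)),
    ∃ a b, a ≠ b ∧ IsSmoothChartAt φ p ∧ IsFaceIn Y φ a ∧ IsFaceIn S₁ φ b ∧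
      (∀ x ∈ φ.source, ∀ c, c ≠ a → c ≠ b → 0 < (φ x).1 c)

/-- The tangent vector `v ∈ T_yΩ` lies in `T_yY`: in a chart in which `Y` is the face
`{x_a = 0}`, one has `dx_a(v) = 0`. -/
def IsTangentTo (Y : Set Ω) (y : Ω) (v : TangentSpace (cornerModel n) y) : Prop :=
  ∃ φ : OpenPartialHomeomorph Ω (EuclideanQuadrant (n + 1)), ∃ a : Fin (n + 1),
    IsSmoothChartAt φ y ∧ y ∈ Y ∧ IsFaceIn Y φ a ∧
      mfderiv (cornerModel n) 𝓘(ℝ, ℝ) (fun x => (φ x).1 a) y v = (0 : ℝ)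

variable (n) in
/-- The critical points of `F`. -/
def criticalSet (F : Ω → ℝ) : Set Ω :=
  {p | mfderiv (cornerModel n) 𝓘(ℝ, ℝ) F p = 0}

variable (n) in
/-- The second derivative of `F` at `p`, in the preferred coordinates at `p`. -/
noncomputable def hessian (F : Ω → ℝ) (p : Ω) :
    EuclideanSpace ℝ (Fin (n + 1)) →L[ℝ] EuclideanSpace ℝ (Fin (n + 1)) →L[ℝ] ℝ :=
  fderivWithin ℝ
    (fun y => fderivWithin ℝ (fun z => F ((extChartAt (cornerModel n) p).symm z))
      (range (cornerModel n)) y)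
    (range (cornerModel n)) (extChartAt (cornerModel n) p p)

variable (n) in
/-- The critical point `p` of `F` is non-degenerate (a Morse critical point). -/
def IsNondegenerateAt (F : Ω → ℝ) (p : Ω) : Prop :=
  ∀ v, (∀ w, hessian n F p v w = 0) → v = 0

variable [IsManifold (cornerModel n) ∞ Ω]

variable (n Ω) in
/-- Smooth Riemannian metrics on `Ω`. -/
abbrev Metric : Type _ :=
  Bundle.ContMDiffRiemannianMetric (cornerModel n) ∞ (EuclideanSpace ℝ (Fin (n + 1)))
    (fun x : Ω => TangentSpace (cornerModel n) x)

theorem exists_gradient (g : Metric n Ω) (F : Ω → ℝ) (x : Ω) :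
    ∃ v : TangentSpace (cornerModel n) x, ∀ w : TangentSpace (cornerModel n) x,
      g.inner x v w = mfderiv (cornerModel n) 𝓘(ℝ, ℝ) F x w := by
  let E := EuclideanSpace ℝ (Fin (n + 1))
  let B : E →ₗ[ℝ] (E →ₗ[ℝ] ℝ) :=
    { toFun := fun v =>
        { toFun := fun w => g.inner x v w
          map_add' := fun w w' => (g.inner x v).map_add w w'
          map_smul' := fun c w => (g.inner x v).map_smul c w }
      map_add' := fun v v' => by
        ext w; exact congrArg (fun T => T w) ((g.inner x).map_add v v')
      map_smul' := fun c v => by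
        ext w; exact congrArg (fun T => T w) ((g.inner x).map_smul c v) }
  have hinj : Function.Injective B := by
    rw [← LinearMap.ker_eq_bot, LinearMap.ker_eq_bot']
    intro v hv
    by_contra hne
    have h1 : 0 < g.inner x v v := g.pos x v hne
    have h2 : g.inner x v v = 0 := congrArg (fun T : E →ₗ[ℝ] ℝ => T v) hv
    exact absurd h2 h1.ne'
  have hsurj : Function.Surjective B :=
    (LinearMap.injective_iff_surjective_of_finrank_eq_finrank
      (Subspace.dual_finrank_eq (K := ℝ) (V := E)).symm).1 hinj
  let L : E →L[ℝ] ℝ := mfderiv (cornerModel n) 𝓘(ℝ, ℝ) F x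
  obtain ⟨v, hv⟩ := hsurj L.toLinearMap
  exact ⟨v, fun w => congrArg (fun T : E →ₗ[ℝ] ℝ => T w) hv⟩

/-- The gradient `∇F` of `F` with respect to the metric `g`. -/
noncomputable def gradient (g : Metric n Ω) (F : Ω → ℝ) (x : Ω) :
    TangentSpace (cornerModel n) x :=
  (exists_gradient g F x).choose

theorem inner_gradient (g : Metric n Ω) (F : Ω → ℝ) (x : Ω)
    (w : TangentSpace (cornerModel n) x) :
    g.inner x (gradient g F x) w = mfderiv (cornerModel n) 𝓘(ℝ, ℝ) F x w :=
  (exists_gradient g F x).choose_spec w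

/-- `F` is a Morse function on the cobordism `(Ω, Y)` between `S₀` and `S₁`, with respect to the
Riemannian metric `g`. -/
structure IsMorseFunction (Y S₀ S₁ : Set Ω) (g : Metric n Ω) (F : Ω → ℝ) : Prop where
  smooth : ContMDiff (cornerModel n) 𝓘(ℝ, ℝ) ∞ F
  mem_Icc : ∀ x, F x ∈ Icc (0 : ℝ) 1
  eq_zero : ∀ x ∈ S₀, F x = 0
  eq_one : ∀ x ∈ S₁, F x = 1
  nondegenerate : ∀ p ∈ criticalSet n F, IsNondegenerateAt n F p
  critical_notMem : ∀ p ∈ criticalSet n F, p ∉ S₀ ∪ S₁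
  tangent : ∀ y ∈ Y, IsTangentTo Y y (gradient g F y)

/-- The stable set `W^s_p`: the points whose trajectory under `∇F` is defined for all
non-negative times and converges to `p` as `t → +∞`. -/
def stableSet (g : Metric n Ω) (F : Ω → ℝ) (p : Ω) : Set Ω :=
  {x | ∃ γ : ℝ → Ω, γ 0 = x ∧
    IsMIntegralCurveOn (I := cornerModel n) γ (gradient g F) (Ici 0) ∧ Tendsto γ atTop (𝓝 p)}

/-- The unstable set `W^u_p`: the points whose trajectory under `∇F` is defined for all
non-positive times and converges to `p` as `t → -∞`. -/
def unstableSet (g : Metric n Ω) (F : Ω → ℝ) (p : Ω) : Set Ω :=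
  {x | ∃ γ : ℝ → Ω, γ 0 = x ∧
    IsMIntegralCurveOn (I := cornerModel n) γ (gradient g F) (Iic 0) ∧ Tendsto γ atBot (𝓝 p)}

/-- `K_p = W^s_p ∪ {p} ∪ W^u_p`. -/
def trajectorySet (g : Metric n Ω) (F : Ω → ℝ) (p : Ω) : Set Ω :=
  stableSet g F p ∪ {p} ∪ unstableSet g F p

end Cobordism

end CornerCobordism

/-!
The metric is not changed: `h = g`, and `G` is built from `F` and from *ascending* functions, that
is, smooth functions `f` whose gradient is tangent to `Y` along `Y` and which satisfy
`⟨∇F, ∇f⟩ ≥ 0`. Ascending functions are stable under sums, under products if they are non-negative,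
and under composition with increasing functions. If `μ` is ascending and locally constant near the
critical points, then adding a non-negative multiple of `μ` to `F` creates no critical points,
respects the boundary condition along `Y`, and shifts the critical values. Hence all amounts to
finding ascending functions with values in `[0, 1]` which are `0` near one given closed set and `1`
near another one.

The obstruction is the relation `Below`: `x` is below `y` if `f x ≤ f y` for all ascending `f`. This
is a closed preorder, and a compactness argument (`exists_isAscending_separating`) shows that two
closed sets can be separated as soon as no point of the upper one is below a point of the lower one.
Since `F` turns out to be strictly increasing for this relation, nothing outside of `S₀` is below a
point of `S₀`, and no point of `S₁` is below a point outside of `S₁`. So the theorem follows once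
neither of the two critical points is below the other one. Suppose that `p` is below `q`. The idea
is that `Below` is the relation of being connected by trajectories of `∇F`, broken at the critical
points; the proof recovers the trajectory from the relation, and thus uses neither flows nor the
stable manifold theorem.

* `Below.exists_mem_frontier`: a relation `x ≤ y` passes through the frontier of every neighbourhood
  of `x`. Otherwise an ascending function near `x` could be cut off and compensated by globally
  ascending functions, to a function which is larger at `x` than at `y` (`not_below_of_local`).
* `exists_forall_le_of_below`: near non-critical points the relation is respected by functions
  which ascend only locally. It follows that `F` is strictly increasing for the relation
  (`Below.eq_of_eq`).
* `Below.exists_curve`: a maximal chain between `p` and `q` is a compact set on which `F` is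
  injective, and has no gaps by the first point, so that it is a curve parametrized by the values of
  `F`.
* `hasDerivAt_comp_of_below`: this curve follows `∇F / |∇F|²`, because near a non-critical point
  `(c + ε) F - k` and `k - (c - ε) F` ascend for every adapted function `k`, if `c` is the quotient
  of `⟨∇F, ∇k⟩` by `|∇F|²`. On `Y`, where not every smooth function is adapted, one uses in addition
  that the curve cannot leave `Y` (`coord_eq_zero_of_below`).
* `Below.exists_mem_trajectorySet`: after a change of parameter the curve is a trajectory of `∇F`.
  It takes infinite time to reach a critical point, since the distance to this point decreases at
  most exponentially. Its points belong to both `K_p` and `K_q`, which are disjoint.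

Finally `G = κ ∘ F + w₁ μ₁ + w₂ μ₂ + w₃ μ₃`, where `κ` is increasing with slope `1` near the
critical values and takes small values on `[0, 1]`, and where the `μᵢ` are steps which raise successively the
points above `S₀`, above the critical point with the smaller new value, and above the other one. The
coefficients `wᵢ` are determined by the values of `G`, and they are non-negative. When the two new
values agree, the critical point with the larger value of `F` has to be treated as the first one.
-/

namespace CornerCobordism

/-! ### Products of gradients -/

section GradientProduct

variable {n : ℕ} {Ω : Type*} [TopologicalSpace Ω] [ChartedSpace (EuclideanQuadrant (n + 1)) Ω]

variable (n) in
/-- `f` is smooth at `x`. -/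
abbrev SmoothAt (f : Ω → ℝ) (x : Ω) : Prop :=
  ContMDiffAt (cornerModel n) 𝓘(ℝ, ℝ) ∞ f x

theorem SmoothAt.mdifferentiableAt {f : Ω → ℝ} {x : Ω} (hf : SmoothAt n f x) :
    MDifferentiableAt (cornerModel n) 𝓘(ℝ, ℝ) f x :=
  ContMDiffAt.mdifferentiableAt hf (by simp)

theorem SmoothAt.comp_real {f : Ω → ℝ} {x : Ω} {θ : ℝ → ℝ} (hf : SmoothAt n f x)
    (hθ : ContDiff ℝ ∞ θ) : SmoothAt n (fun y => θ (f y)) x :=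
  (hθ.contMDiff.contMDiffAt (x := f x)).comp x hf

variable [IsManifold (cornerModel n) ∞ Ω]

/-- The inner product `⟨∇f, ∇k⟩` of the gradients of `f` and `k`, that is, the derivative of `k`
along `∇f`. -/
noncomputable def gradProd (g : Metric n Ω) (f k : Ω → ℝ) (x : Ω) : ℝ :=
  g.inner x (gradient g f x) (gradient g k x)

variable {g : Metric n Ω} {f k l : Ω → ℝ} {x : Ω}

theorem gradProd_comm : gradProd g f k x = gradProd g k f x := g.symm x _ _

theorem gradProd_eq : gradProd g f k x =
    (mfderiv (cornerModel n) 𝓘(ℝ, ℝ) k x (gradient g f x) : ℝ) := by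
  rw [gradProd_comm]; exact inner_gradient g k x _

theorem gradProd_congr (h : f =ᶠ[𝓝 x] l) : gradProd g k f x = gradProd g k l x := by
  rw [gradProd_eq, gradProd_eq, h.mfderiv_eq]; rfl

theorem gradProd_add (hf : SmoothAt n f x) (hk : SmoothAt n k x) :
    gradProd g l (fun y => f y + k y) x = gradProd g l f x + gradProd g l k x := by
  simp only [gradProd_eq]
  have := mfderiv_add hf.mdifferentiableAt hk.mdifferentiableAt
  exact congrArg (fun T => T (gradient g l x)) this

theorem gradProd_mul (hf : SmoothAt n f x) (hk : SmoothAt n k x) :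
    gradProd g l (fun y => f y * k y) x =
      f x * gradProd g l k x + k x * gradProd g l f x := by
  simp only [gradProd_eq]
  have := (hf.mdifferentiableAt.hasMFDerivAt.mul hk.mdifferentiableAt.hasMFDerivAt).mfderiv
  exact congrArg (fun T => T (gradient g l x)) this

theorem gradProd_comp {θ : ℝ → ℝ} (hθ : Differentiable ℝ θ) (hf : SmoothAt n f x) :
    gradProd g l (fun y => θ (f y)) x = deriv θ (f x) * gradProd g l f x := by
  simp only [gradProd_eq]
  have h1 := ((hθ (f x)).hasDerivAt.hasFDerivAt.hasMFDerivAt.comp x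
    hf.mdifferentiableAt.hasMFDerivAt).mfderiv
  have := congrArg (fun T => T (gradient g l x)) h1
  refine this.trans ?_
  exact mul_comm (G := ℝ) (mfderiv (cornerModel n) 𝓘(ℝ, ℝ) f x (gradient g l x)) _

theorem gradProd_const (c : ℝ) : gradProd g l (fun _ => c) x = 0 := by
  rw [gradProd_eq, mfderiv_const]; rfl

theorem gradProd_const_mul (c : ℝ) (hf : SmoothAt n f x) :
    gradProd g l (fun y => c * f y) x = c * gradProd g l f x := by
  rw [gradProd_mul contMDiffAt_const hf, gradProd_const]; ring

theorem gradProd_neg (hf : SmoothAt n f x) :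
    gradProd g l (fun y => - f y) x = - gradProd g l f x := by
  have := gradProd_const_mul (g := g) (l := l) (-1) hf
  simpa using this

theorem gradProd_sub (hf : SmoothAt n f x) (hk : SmoothAt n k x) :
    gradProd g l (fun y => f y - k y) x = gradProd g l f x - gradProd g l k x := by
  simp only [sub_eq_add_neg]
  rw [gradProd_add hf hk.neg, gradProd_neg hk]

theorem gradProd_sub_const (c : ℝ) (hf : SmoothAt n f x) :
    gradProd g l (fun y => f y - c) x = gradProd g l f x := by
  rw [gradProd_sub hf contMDiffAt_const, gradProd_const, sub_zero]

theorem gradProd_sum {ι : Type*} (s : Finset ι) {f : ι → Ω → ℝ}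
    (hf : ∀ i ∈ s, SmoothAt n (f i) x) :
    gradProd g l (fun y => ∑ i ∈ s, f i y) x = ∑ i ∈ s, gradProd g l (f i) x := by
  classical
  induction s using Finset.induction_on with
  | empty => simpa using gradProd_const 0
  | insert a s ha ih =>
    simp only [Finset.sum_insert ha]
    rw [gradProd_add (hf a (by simp)) (contMDiffAt_finsetSum fun i hi => hf i (by simp [hi])),
      ih fun i hi => hf i (by simp [hi])]

theorem gradient_eq_zero_iff :
    gradient g f x = 0 ↔ mfderiv (cornerModel n) 𝓘(ℝ, ℝ) f x = 0 := by
  constructor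
  · intro h
    ext w
    rw [← inner_gradient g f x w, h]
    exact congrArg (fun T => T w) (map_zero (g.inner x))
  · intro h
    by_contra hne
    have h1 := g.pos x _ hne
    rw [inner_gradient, h] at h1
    exact lt_irrefl _ h1

theorem gradProd_self_pos (h : x ∉ criticalSet n f) : 0 < gradProd g f f x :=
  g.pos x _ fun h0 => h (gradient_eq_zero_iff.1 h0)

theorem gradProd_of_mem_criticalSet (h : x ∈ criticalSet n k) : gradProd g f k x = 0 := by
  rw [gradProd_eq, show mfderiv (cornerModel n) 𝓘(ℝ, ℝ) k x = 0 from h]; rfl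

theorem gradProd_self_nonneg : 0 ≤ gradProd g f f x := by
  by_cases h : x ∈ criticalSet n f
  · rw [gradProd_of_mem_criticalSet h]
  · exact (gradProd_self_pos h).le

open Bundle in
/-- In a trivialization of the tangent bundle, `⟨∇f, ∇k⟩` is obtained from the differentials of `f`
and `k` by inverting the metric. -/
theorem SmoothAt.gradProd {x₀ : Ω} (hf : SmoothAt n f x₀) (hk : SmoothAt n k x₀) :
    SmoothAt n (gradProd g f k) x₀ := by
  let E := EuclideanSpace ℝ (Fin (n + 1))
  let T : Ω → Type := fun x => TangentSpace (cornerModel n) x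
  -- the metric and the differentials of `f` and `k`, read in the trivialization at `x₀`
  let B : Ω → E →L[ℝ] E →L[ℝ] ℝ := fun x =>
    ContinuousLinearMap.inCoordinates E T (E →L[ℝ] ℝ)
      (fun x => T x →L[ℝ] Trivial Ω ℝ x) x₀ x x₀ x (g.inner x)
  let a : (Ω → ℝ) → Ω → E →L[ℝ] ℝ := fun f =>
    inTangentCoordinates (cornerModel n) 𝓘(ℝ, ℝ) id f (mfderiv (cornerModel n) 𝓘(ℝ, ℝ) f) x₀
  have hB : ContMDiffAt (cornerModel n) 𝓘(ℝ, E →L[ℝ] E →L[ℝ] ℝ) ∞ B x₀ :=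
    ((contMDiffAt_hom_bundle _).1 (g.contMDiff x₀)).2
  have ha : ∀ {f : Ω → ℝ}, SmoothAt n f x₀ →
      ContMDiffAt (cornerModel n) 𝓘(ℝ, E →L[ℝ] ℝ) ∞ (a f) x₀ := fun hf =>
    hf.mfderiv_const (by simp)
  let e := trivializationAt E T x₀
  have hBe : ∀ x (hx : x ∈ e.baseSet) v w, B x v w =
      g.inner x ((e.continuousLinearEquivAt ℝ x hx).symm v)
        ((e.continuousLinearEquivAt ℝ x hx).symm w) := by
    intro x hx v w
    simp only [B]
    rw [inCoordinates_apply_eq₂ hx hx (mem_univ _)]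
    simp [e, T]
  have hae : ∀ (f : Ω → ℝ) x (hx : x ∈ e.baseSet) v, a f x v =
      (mfderiv (cornerModel n) 𝓘(ℝ, ℝ) f x ((e.continuousLinearEquivAt ℝ x hx).symm v) : ℝ) := by
    intro f x hx v
    have h1 := ContinuousLinearMap.inCoordinates_eq (F' := ℝ) (E' := TangentSpace 𝓘(ℝ, ℝ))
      (y₀ := f x₀) (y := f x) (ϕ := mfderiv (cornerModel n) 𝓘(ℝ, ℝ) f x) hx
      (by rw [TangentBundle.trivializationAt_baseSet, chartAt_self_eq]; exact mem_univ _)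
    refine (congrArg (fun L : E →L[ℝ] ℝ => L v) h1).trans ?_
    simp [e, T]
    rfl
  have hinj : ∀ x (hx : x ∈ e.baseSet), ∃ M : E ≃L[ℝ] (E →L[ℝ] ℝ), M = B x := by
    intro x hx
    have h1 : Function.Injective (B x) := by
      refine (injective_iff_map_eq_zero _).2 fun v hv => ?_
      by_contra hne
      have h2 := g.pos x ((e.continuousLinearEquivAt ℝ x hx).symm v)
        ((e.continuousLinearEquivAt ℝ x hx).symm.map_ne_zero_iff.2 hne)
      rw [← hBe, hv] at h2
      exact lt_irrefl _ h2
    have h4 : Module.finrank ℝ E = Module.finrank ℝ (E →L[ℝ] ℝ) := by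
      rw [← (LinearMap.toContinuousLinearMap (𝕜 := ℝ) (E := E) (F' := ℝ)).finrank_eq]
      exact Subspace.dual_finrank_eq.symm
    refine ⟨((B x).toLinearMap.linearEquivOfInjective h1 h4).toContinuousLinearEquiv, ?_⟩
    ext v w
    rfl
  have hgr : ∀ x (hx : x ∈ e.baseSet), (B x).inverse (a f x) =
      e.continuousLinearEquivAt ℝ x hx (gradient g f x) := by
    intro x hx
    obtain ⟨M, hM⟩ := hinj x hx
    rw [← hM, ContinuousLinearMap.inverse_equiv]
    apply M.injective
    ext w
    refine (congrArg (fun L : E →L[ℝ] ℝ => L w) (M.apply_symm_apply (a f x))).trans ?_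
    have h5 := hBe x hx (e.continuousLinearEquivAt ℝ x hx (gradient g f x)) w
    rw [ContinuousLinearEquiv.symm_apply_apply, inner_gradient] at h5
    rw [hae f x hx]
    refine h5.symm.trans ?_
    rw [← hM]
    rfl
  have hx₀ : x₀ ∈ e.baseSet := FiberBundle.mem_baseSet_trivializationAt' x₀
  have hmain : SmoothAt n (fun x => a k x ((B x).inverse (a f x))) x₀ := by
    obtain ⟨M, hM⟩ := hinj x₀ hx₀
    have h3 : ContDiffAt ℝ ∞ ContinuousLinearMap.inverse (B x₀) := hM ▸ contDiffAt_map_inverse M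
    exact (ha hk).clm_apply ((h3.contMDiffAt.comp x₀ hB).clm_apply (ha hf))
  refine hmain.congr_of_eventuallyEq ?_
  filter_upwards [e.open_baseSet.mem_nhds hx₀] with x hx
  rw [hgr x hx, hae k x hx, gradProd_eq, ContinuousLinearEquiv.symm_apply_apply]

end GradientProduct

/-! ### Charts adapted to a face -/

section Charts

variable {n : ℕ} {Ω : Type*} [TopologicalSpace Ω] [ChartedSpace (EuclideanQuadrant (n + 1)) Ω]

theorem mem_range_cornerModel {z : EuclideanSpace ℝ (Fin (n + 1))} :
    z ∈ range (cornerModel n) ↔ ∀ i, 0 ≤ z i := by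
  have : range (cornerModel n) = {y | ∀ i, 0 ≤ y i} := range_euclideanQuadrant (n + 1)
  rw [this]; rfl

theorem convex_range_cornerModel : Convex ℝ (range (cornerModel n)) := by
  intro x hx y hy a b ha hb _
  rw [mem_range_cornerModel] at *
  intro i
  have h1 := mul_nonneg ha (hx i)
  have h2 := mul_nonneg hb (hy i)
  simpa using add_nonneg h1 h2

variable {φ : OpenPartialHomeomorph Ω (EuclideanQuadrant (n + 1))} {a : Fin (n + 1)}
  {Y : Set Ω} {f u : Ω → ℝ} {x y : Ω}

theorem IsSmoothChartAt.contDiffWithinAt (hφ : IsSmoothChartAt φ x) (hf : SmoothAt n f x) :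
    ContDiffWithinAt ℝ ∞ (fun z => f ((φ.extend (cornerModel n)).symm z)) (range (cornerModel n))
      (φ.extend (cornerModel n) x) :=
  ((contMDiffAt_iff_of_mem_maximalAtlas (e' := OpenPartialHomeomorph.refl ℝ) hφ.1
    (IsManifold.subset_maximalAtlas (by simp)) hφ.2
    (mem_univ _)).1 hf).2

theorem IsSmoothChartAt.contMDiffAt_extend (hφ : IsSmoothChartAt φ x) :
    ContMDiffAt (cornerModel n) 𝓘(ℝ, EuclideanSpace ℝ (Fin (n + 1))) ∞
      (φ.extend (cornerModel n)) x :=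
  φ.contMDiffAt_extend hφ.1 hφ.2

theorem IsSmoothChartAt.smoothAt_coord (hφ : IsSmoothChartAt φ x) (a : Fin (n + 1)) :
    SmoothAt n (fun y => (φ y).1 a) x :=
  ((EuclideanSpace.proj a : EuclideanSpace ℝ (Fin (n + 1)) →L[ℝ] ℝ).contMDiff.contMDiffAt).comp x
    hφ.contMDiffAt_extend

variable (n) in
/-- The differential of the function `f` at `x`, as a linear form on the model space. -/
noncomputable def differential (f : Ω → ℝ) (x : Ω) : EuclideanSpace ℝ (Fin (n + 1)) →L[ℝ] ℝ :=
  mfderiv (cornerModel n) 𝓘(ℝ, ℝ) f x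

/-- The differential of the chart `φ` at `x`, as an endomorphism of the model space. -/
noncomputable def chartDifferential (φ : OpenPartialHomeomorph Ω (EuclideanQuadrant (n + 1)))
    (x : Ω) : EuclideanSpace ℝ (Fin (n + 1)) →L[ℝ] EuclideanSpace ℝ (Fin (n + 1)) :=
  mfderiv (cornerModel n) 𝓘(ℝ, EuclideanSpace ℝ (Fin (n + 1))) (φ.extend (cornerModel n)) x

theorem IsSmoothChartAt.differential_coord (hφ : IsSmoothChartAt φ x) (a : Fin (n + 1))
    (v : EuclideanSpace ℝ (Fin (n + 1))) :
    differential n (fun y => (φ y).1 a) x v = chartDifferential φ x v a := by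
  have h1 := (EuclideanSpace.proj a : EuclideanSpace ℝ (Fin (n + 1)) →L[ℝ] ℝ).hasMFDerivAt
    (x := φ.extend (cornerModel n) x)
  have h2 := (hφ.contMDiffAt_extend.mdifferentiableAt (by simp)).hasMFDerivAt
  exact congrArg (fun T => T v) (h1.comp x h2).mfderiv

theorem IsSmoothChartAt.tendsto_symm (hφ : IsSmoothChartAt φ x) :
    Tendsto (φ.extend (cornerModel n)).symm (𝓝 (φ.extend (cornerModel n) x)) (𝓝 x) := by
  have := φ.continuousAt_extend_symm (I := cornerModel n) hφ.2
  rwa [ContinuousAt, φ.extend_left_inv hφ.2] at this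

/-- The differential of `f` in terms of the derivative of its expression in a chart. -/
theorem IsSmoothChartAt.differential_eq (hφ : IsSmoothChartAt φ x)
    {L : EuclideanSpace ℝ (Fin (n + 1)) →L[ℝ] ℝ}
    (hL : HasFDerivWithinAt (fun z => f ((φ.extend (cornerModel n)).symm z)) L
      (range (cornerModel n)) (φ.extend (cornerModel n) x))
    (v : EuclideanSpace ℝ (Fin (n + 1))) :
    differential n f x v = L (chartDifferential φ x v) := by
  have h2 := (hφ.contMDiffAt_extend.mdifferentiableAt (by simp)).hasMFDerivAt
  have h3 := hL.hasMFDerivWithinAt.comp x (s := univ) (hasMFDerivWithinAt_univ.2 h2)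
    (fun z _ => mem_range_self _)
  have h4 := hasMFDerivWithinAt_univ.1 h3
  have h5 := h4.congr_of_eventuallyEq (f₁ := f) (by
    filter_upwards [φ.open_source.mem_nhds hφ.2] with z hz
    simp [Function.comp, φ.left_inv hz])
  exact congrArg (fun T => T v) h5.mfderiv

/-- The differential of a chart is surjective, also at boundary points, since the image of the chart
is a set of unique differentiability. -/
theorem IsSmoothChartAt.exists_chartDifferential_eq (hφ : IsSmoothChartAt φ x)
    (w : EuclideanSpace ℝ (Fin (n + 1))) : ∃ v, chartDifferential φ x v = w := by
  set e := φ.extend (cornerModel n) with he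
  have hx : e.symm (e x) = x := φ.extend_left_inv hφ.2
  have h3 : MDifferentiableWithinAt 𝓘(ℝ, EuclideanSpace ℝ (Fin (n + 1))) (cornerModel n) e.symm
      (range (cornerModel n)) (e x) := by
    have h4 := (contMDiffOn_extend_symm hφ.1) (e x)
      (mem_image_of_mem _ (φ.map_source hφ.2))
    rw [← OpenPartialHomeomorph.extend_target'] at h4
    exact (h4.mono_of_mem_nhdsWithin (φ.extend_target_mem_nhdsWithin hφ.2)).mdifferentiableWithinAt
      (by simp)
  have h5 := h3.hasMFDerivWithinAt
  have h2 : HasMFDerivAt (cornerModel n) 𝓘(ℝ, EuclideanSpace ℝ (Fin (n + 1))) e (e.symm (e x))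
      (chartDifferential φ x) := by
    rw [hx]
    exact (hφ.contMDiffAt_extend.mdifferentiableAt (by simp)).hasMFDerivAt
  let D : EuclideanSpace ℝ (Fin (n + 1)) →L[ℝ] EuclideanSpace ℝ (Fin (n + 1)) :=
    mfderivWithin 𝓘(ℝ, EuclideanSpace ℝ (Fin (n + 1))) (cornerModel n) e.symm
      (range (cornerModel n)) (e x)
  have h6 : HasFDerivWithinAt (e ∘ e.symm) ((chartDifferential φ x).comp D)
      (range (cornerModel n)) (e x) := (h2.comp_hasMFDerivWithinAt (e x) h5).hasFDerivWithinAt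
  have h7 : HasFDerivWithinAt (fun z : EuclideanSpace ℝ (Fin (n + 1)) => z)
    (ContinuousLinearMap.id ℝ _) (range (cornerModel n)) (e x) := hasFDerivWithinAt_id _ _
  have h8 := h7.congr_of_eventuallyEq (f₁ := e ∘ e.symm) (by
      filter_upwards [φ.extend_target_mem_nhdsWithin hφ.2] with z hz
      exact e.right_inv hz) (by simp [hx])
  have h9 := ((cornerModel n).uniqueDiffOn _ (mem_range_self _)).eq h6 h8
  exact ⟨D w, congrArg (fun T => T w) h9⟩

/-- A smooth function which vanishes on a coordinate face has differential proportional to that of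
the coordinate. -/
theorem IsSmoothChartAt.exists_differential_eq_mul (hφ : IsSmoothChartAt φ y) (hy : y ∈ Y)
    (ha : IsFaceIn Y φ a) (hu : SmoothAt n u y) (hu0 : ∀ᶠ x in 𝓝 y, x ∈ Y → u x = 0) :
    ∃ c : ℝ, ∀ v, differential n u y v = c * differential n (fun x => (φ x).1 a) y v := by
  set e := φ.extend (cornerModel n) with he
  have hdiff : DifferentiableWithinAt ℝ (fun z => u (e.symm z)) (range (cornerModel n)) (e y) :=
    (hφ.contDiffWithinAt hu).differentiableWithinAt (by simp)
  set L := fderivWithin ℝ (fun z => u (e.symm z)) (range (cornerModel n)) (e y)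
  have hL := hdiff.hasFDerivWithinAt
  have hya : (φ y).1 a = 0 := (ha y hφ.2).1 hy
  -- in the chart, `u` vanishes on the rays which start at `φ y` in the directions of the face
  have hzero : ∀ c, c ≠ a → L (EuclideanSpace.single c 1) = 0 := by
    intro c hc
    have h1 : HasDerivWithinAt (fun t : ℝ => e y + t • EuclideanSpace.single c (1 : ℝ))
        (EuclideanSpace.single c 1) (Ici 0) 0 := by
      simpa using ((hasDerivWithinAt_id (0 : ℝ) (Ici 0)).smul_const
        (EuclideanSpace.single c (1 : ℝ))).const_add (e y)
    have hmaps : MapsTo (fun t : ℝ => e y + t • EuclideanSpace.single c (1 : ℝ)) (Ici 0)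
        (range (cornerModel n)) := by
      intro t ht
      rw [mem_range_cornerModel]
      intro i
      have h2 : 0 ≤ e y i := (φ y).2 i
      have h3 : 0 ≤ t * (EuclideanSpace.single c (1 : ℝ)) i := by
        refine mul_nonneg ht ?_
        simp only [PiLp.single_apply]
        split_ifs <;> simp
      simpa using add_nonneg h2 h3
    have h4 : HasDerivWithinAt
        ((fun z => u (e.symm z)) ∘ (fun t : ℝ => e y + t • EuclideanSpace.single c (1 : ℝ)))
        (L (EuclideanSpace.single c 1)) (Ici 0) 0 := by
      refine HasFDerivWithinAt.comp_hasDerivWithinAt_of_eq (0 : ℝ) hL h1 hmaps (by simp)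
    have htend : Tendsto (fun t : ℝ => e y + t • EuclideanSpace.single c (1 : ℝ)) (𝓝[Ici 0] 0)
        (𝓝[range (cornerModel n)] (e y)) := by
      have := h1.continuousWithinAt.tendsto_nhdsWithin hmaps
      simpa using this
    have h5 : ∀ᶠ z in 𝓝[range (cornerModel n)] (e y), z a = 0 → u (e.symm z) = 0 := by
      have h6 := (hφ.tendsto_symm.mono_left
        (nhdsWithin_le_nhds (s := range (cornerModel n)))).eventually hu0
      filter_upwards [h6, φ.extend_target_mem_nhdsWithin hφ.2] with z hz hz2 hza
      refine hz ((ha _ (φ.extend_source (I := cornerModel n) ▸ e.map_target hz2)).2 ?_)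
      have : (φ (e.symm z)).1 = z := e.right_inv hz2
      rw [this, hza]
    have h7 := htend.eventually h5
    have h8 : HasDerivWithinAt
        ((fun z => u (e.symm z)) ∘ (fun t : ℝ => e y + t • EuclideanSpace.single c (1 : ℝ)))
        0 (Ici 0) 0 := by
      refine (hasDerivWithinAt_const (0 : ℝ) (Ici 0) (0 : ℝ)).congr_of_eventuallyEq_of_mem ?_
        (mem_Ici.2 le_rfl)
      filter_upwards [h7] with t ht
      refine ht ?_
      have h9 : e y a = 0 := hya
      simp [h9, Ne.symm hc]
    exact (uniqueDiffOn_Ici (0 : ℝ) 0 (mem_Ici.2 le_rfl)).eq_deriv _ h4 h8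
  refine ⟨L (EuclideanSpace.single a 1), fun v => ?_⟩
  rw [hφ.differential_eq hL, hφ.differential_coord]
  set w := chartDifferential φ y v
  have hw : w = ∑ i, w i • EuclideanSpace.single i (1 : ℝ) := by
    ext j
    simp [Pi.single_apply]
  conv_lhs => rw [hw]
  rw [map_sum, Finset.sum_eq_single a]
  · rw [map_smul, smul_eq_mul, mul_comm]
  · intro b _ hb
    rw [map_smul, hzero b hb, smul_zero]
  · simp

/-- A smooth function is Lipschitz near each point, with respect to the distance in a chart. -/
theorem IsSmoothChartAt.exists_lipschitz (hφ : IsSmoothChartAt φ y) (hu : SmoothAt n u y) :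
    ∃ K : ℝ, 0 ≤ K ∧ ∀ᶠ p : Ω × Ω in 𝓝 (y, y), |u p.1 - u p.2| ≤ K * ‖(φ p.1).1 - (φ p.2).1‖ := by
  obtain ⟨K, t, ht, hK⟩ := ((hφ.contDiffWithinAt hu).of_le (m := 1)
    (by exact_mod_cast le_top)).exists_lipschitzOnWith convex_range_cornerModel
  refine ⟨K, K.2, ?_⟩
  have h1 : ∀ᶠ x in 𝓝 y, φ.extend (cornerModel n) x ∈ t ∧ x ∈ φ.source := by
    have h2 : Tendsto (φ.extend (cornerModel n)) (𝓝 y)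
        (𝓝[range (cornerModel n)] (φ.extend (cornerModel n) y)) :=
      tendsto_nhdsWithin_iff.2 ⟨φ.continuousAt_extend hφ.2,
        Eventually.of_forall fun _ => mem_range_self _⟩
    exact (h2.eventually ht).and (φ.open_source.mem_nhds hφ.2)
  filter_upwards [h1.prod_nhds h1] with p hp
  have h3 := hK.dist_le_mul _ hp.1.1 _ hp.2.1
  rw [φ.extend_left_inv hp.1.2, φ.extend_left_inv hp.2.2, Real.dist_eq, dist_eq_norm] at h3
  exact h3

/-- A smooth function which vanishes on a coordinate face is bounded by a multiple of the
coordinate. -/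
theorem IsSmoothChartAt.exists_abs_le_mul_coord (hφ : IsSmoothChartAt φ y) (hy : y ∈ Y)
    (ha : IsFaceIn Y φ a) (hu : SmoothAt n u y) (hu0 : ∀ᶠ x in 𝓝 y, x ∈ Y → u x = 0) :
    ∃ K : ℝ, 0 ≤ K ∧ ∀ᶠ x in 𝓝 y, |u x| ≤ K * (φ x).1 a := by
  obtain ⟨K, hK0, hK⟩ := hφ.exists_lipschitz hu
  refine ⟨K, hK0, ?_⟩
  set e := φ.extend (cornerModel n) with he
  -- the projection to the face, in the chart
  let P : EuclideanSpace ℝ (Fin (n + 1)) → EuclideanSpace ℝ (Fin (n + 1)) :=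
    fun z => z - z a • EuclideanSpace.single a (1 : ℝ)
  have hP : Continuous P := by fun_prop
  have hPy : P (e y) = e y := by
    have : e y a = 0 := (ha y hφ.2).1 hy
    simp [P, this]
  have hPa : ∀ z, P z a = 0 := fun z => by simp [P]
  have hPr : ∀ z ∈ range (cornerModel n), P z ∈ range (cornerModel n) := by
    intro z hz
    rw [mem_range_cornerModel] at *
    intro i
    by_cases h : i = a
    · subst h; rw [hPa]
    · simpa [P, PiLp.single_apply, h] using hz i
  have h1 : Tendsto (fun x => P (e x)) (𝓝 y) (𝓝[range (cornerModel n)] (e y)) := by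
    refine tendsto_nhdsWithin_iff.2 ⟨?_, Eventually.of_forall fun x => hPr _ (mem_range_self _)⟩
    have := (hP.tendsto (e y)).comp (φ.continuousAt_extend (I := cornerModel n) hφ.2)
    rwa [hPy] at this
  have h2 : Tendsto (fun x => e.symm (P (e x))) (𝓝 y) (𝓝 y) :=
    hφ.tendsto_symm.comp (h1.mono_right nhdsWithin_le_nhds)
  have h3 : Tendsto (fun x => (x, e.symm (P (e x)))) (𝓝 y) (𝓝 (y, y)) :=
    tendsto_id.prodMk_nhds h2
  filter_upwards [h3.eventually hK, h2.eventually hu0,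
    h1.eventually (φ.extend_target_mem_nhdsWithin hφ.2)] with x hx hx0 hxt
  have h4 : (φ (e.symm (P (e x)))).1 = P (e x) := e.right_inv hxt
  have h5 : e.symm (P (e x)) ∈ Y := by
    refine (ha _ (φ.extend_source (I := cornerModel n) ▸ e.map_target hxt)).2 ?_
    rw [h4, hPa]
  rw [hx0 h5, sub_zero, h4] at hx
  have h6 : (φ x).1 - P (e x) = (φ x).1 a • EuclideanSpace.single a (1 : ℝ) := by
    simp only [P]
    exact sub_sub_cancel _ _
  rw [h6, norm_smul] at hx
  simpa [abs_of_nonneg ((φ x).2 a)] using hx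

/-- A smooth function which vanishes at a point is bounded by a multiple of the distance to this
point in a chart. -/
theorem IsSmoothChartAt.exists_abs_le_mul_norm (hφ : IsSmoothChartAt φ y) (hu : SmoothAt n u y)
    (hu0 : u y = 0) : ∃ K : ℝ, 0 ≤ K ∧ ∀ᶠ x in 𝓝 y, |u x| ≤ K * ‖(φ x).1 - (φ y).1‖ := by
  obtain ⟨K, hK0, hK⟩ := hφ.exists_lipschitz hu
  refine ⟨K, hK0, ?_⟩
  have h3 : Tendsto (fun x => (x, y)) (𝓝 y) (𝓝 (y, y)) := tendsto_id.prodMk_nhds tendsto_const_nhds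
  filter_upwards [h3.eventually hK] with x hx
  simpa [hu0] using hx

theorem IsSmoothChartAt.coord_notMem_criticalSet (hφ : IsSmoothChartAt φ x) (a : Fin (n + 1)) :
    x ∉ criticalSet n (fun y => (φ y).1 a) := by
  intro h
  obtain ⟨v, hv⟩ := hφ.exists_chartDifferential_eq (EuclideanSpace.single a (1 : ℝ))
  have h1 := hφ.differential_coord a v
  rw [hv, show differential n (fun y => (φ y).1 a) x = 0 from h] at h1
  simp at h1

variable [IsManifold (cornerModel n) ∞ Ω] {k : Ω → ℝ} {g : Metric n Ω}

theorem gradProd_eq_differential : gradProd g f k x = differential n k x (gradient g f x) :=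
  gradProd_eq

/-- Whether a gradient is tangent to `Y` may be tested in any chart in which `Y` is a coordinate
face. -/
theorem isTangentTo_gradient_iff (hφ : IsSmoothChartAt φ y) (hy : y ∈ Y) (ha : IsFaceIn Y φ a) :
    IsTangentTo Y y (gradient g f y) ↔ gradProd g f (fun x => (φ x).1 a) y = 0 := by
  constructor
  · rintro ⟨ψ, b, hψ, -, hb, h⟩
    obtain ⟨c, hc⟩ := hψ.exists_differential_eq_mul hy hb (hφ.smoothAt_coord a) (by
      filter_upwards [φ.open_source.mem_nhds hφ.2] with x hx hxY
      exact (ha x hx).1 hxY)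
    refine gradProd_eq_differential.trans ((hc _).trans ?_)
    rw [show differential n (fun x => (ψ x).1 b) y (gradient g f y) = 0 from h, mul_zero]
  · intro h
    exact ⟨φ, a, hφ, hy, ha, by rw [← h, gradProd_eq]⟩

end Charts

/-! ### Functions whose gradient is tangent to `Y` -/

section Adapted

variable {n : ℕ} {Ω : Type*} [TopologicalSpace Ω] [ChartedSpace (EuclideanQuadrant (n + 1)) Ω]

variable (n) in
/-- Every point of `Y` has a smooth chart in which `Y` is a coordinate face. -/
def HasFaceCharts (Y : Set Ω) : Prop :=
  ∀ y ∈ Y, ∃ φ : OpenPartialHomeomorph Ω (EuclideanQuadrant (n + 1)), ∃ a,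
    IsSmoothChartAt φ y ∧ IsFaceIn Y φ a

theorem IsCobordism.hasFaceCharts {Y S₀ S₁ : Set Ω} (h : IsCobordism n Y S₀ S₁) :
    HasFaceCharts n Y := by
  intro y hy
  by_cases h₀ : y ∈ S₀
  · obtain ⟨φ, a, b, -, hφ, ha, -⟩ := h.chart_M₀ y ⟨hy, h₀⟩
    exact ⟨φ, a, hφ, ha⟩
  by_cases h₁ : y ∈ S₁
  · obtain ⟨φ, a, b, -, hφ, ha, -⟩ := h.chart_M₁ y ⟨hy, h₁⟩
    exact ⟨φ, a, hφ, ha⟩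
  · obtain ⟨φ, a, hφ, ha, -⟩ := h.chart_Y y ⟨hy, by simp [h₀, h₁]⟩
    exact ⟨φ, a, hφ, ha⟩

variable [IsManifold (cornerModel n) ∞ Ω]

/-- `f` is smooth at `x` and, if `x` lies on `Y`, its gradient at `x` is tangent to `Y`. -/
def AdaptedAt (g : Metric n Ω) (Y : Set Ω) (f : Ω → ℝ) (x : Ω) : Prop :=
  SmoothAt n f x ∧ (x ∈ Y → IsTangentTo Y x (gradient g f x))

variable {g : Metric n Ω} {Y : Set Ω} {f k : Ω → ℝ} {x : Ω}

theorem AdaptedAt.smoothAt (h : AdaptedAt g Y f x) : SmoothAt n f x := h.1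

theorem AdaptedAt.continuousAt (h : AdaptedAt g Y f x) : ContinuousAt f x :=
  ContMDiffAt.continuousAt h.1

theorem adaptedAt_of_forall (hf : SmoothAt n f x)
    (h : ∀ (φ : OpenPartialHomeomorph Ω (EuclideanQuadrant (n + 1))) (a : Fin (n + 1)), x ∈ Y →
      IsSmoothChartAt φ x → IsFaceIn Y φ a → gradProd g f (fun y => (φ y).1 a) x = 0)
    (hY : HasFaceCharts n Y) : AdaptedAt g Y f x := by
  refine ⟨hf, fun hx => ?_⟩
  obtain ⟨φ, a, hφ, ha⟩ := hY x hx
  exact (isTangentTo_gradient_iff hφ hx ha).2 (h φ a hx hφ ha)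

theorem AdaptedAt.gradProd_eq_zero {φ : OpenPartialHomeomorph Ω (EuclideanQuadrant (n + 1))}
    {a : Fin (n + 1)} (h : AdaptedAt g Y f x) (hx : x ∈ Y) (hφ : IsSmoothChartAt φ x)
    (ha : IsFaceIn Y φ a) : gradProd g f (fun y => (φ y).1 a) x = 0 :=
  (isTangentTo_gradient_iff hφ hx ha).1 (h.2 hx)

theorem AdaptedAt.congr (hY : HasFaceCharts n Y) (h : AdaptedAt g Y f x) (hk : k =ᶠ[𝓝 x] f) :
    AdaptedAt g Y k x := by
  refine adaptedAt_of_forall (h.1.congr_of_eventuallyEq hk) (fun φ a hx hφ ha => ?_) hY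
  rw [gradProd_comm, gradProd_congr hk, gradProd_comm, h.gradProd_eq_zero hx hφ ha]

theorem adaptedAt_const (hY : HasFaceCharts n Y) (c : ℝ) : AdaptedAt g Y (fun _ => c) x := by
  refine adaptedAt_of_forall contMDiffAt_const (fun φ a hx hφ ha => ?_) hY
  rw [gradProd_comm, gradProd_const]

theorem AdaptedAt.add (hY : HasFaceCharts n Y) (hf : AdaptedAt g Y f x) (hk : AdaptedAt g Y k x) :
    AdaptedAt g Y (fun y => f y + k y) x := by
  refine adaptedAt_of_forall (ContMDiffAt.add hf.1 hk.1) (fun φ a hx hφ ha => ?_) hY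
  rw [gradProd_comm, gradProd_add hf.1 hk.1, gradProd_comm, hf.gradProd_eq_zero hx hφ ha,
    gradProd_comm, hk.gradProd_eq_zero hx hφ ha, add_zero]

theorem AdaptedAt.mul (hY : HasFaceCharts n Y) (hf : AdaptedAt g Y f x) (hk : AdaptedAt g Y k x) :
    AdaptedAt g Y (fun y => f y * k y) x := by
  refine adaptedAt_of_forall (ContMDiffAt.mul hf.1 hk.1) (fun φ a hx hφ ha => ?_) hY
  rw [gradProd_comm, gradProd_mul hf.1 hk.1, gradProd_comm, hk.gradProd_eq_zero hx hφ ha,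
    gradProd_comm, hf.gradProd_eq_zero hx hφ ha, mul_zero, mul_zero, add_zero]

theorem AdaptedAt.comp (hY : HasFaceCharts n Y) (hf : AdaptedAt g Y f x) {θ : ℝ → ℝ}
    (hθ : ContDiff ℝ ∞ θ) : AdaptedAt g Y (fun y => θ (f y)) x := by
  refine adaptedAt_of_forall (hf.1.comp_real hθ) (fun φ a hx hφ ha => ?_) hY
  rw [gradProd_comm, gradProd_comp (hθ.differentiable (by simp)) hf.1, gradProd_comm,
    hf.gradProd_eq_zero hx hφ ha, mul_zero]

theorem AdaptedAt.const_mul (hY : HasFaceCharts n Y) (hf : AdaptedAt g Y f x) (c : ℝ) :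
    AdaptedAt g Y (fun y => c * f y) x :=
  (adaptedAt_const hY c).mul hY hf

theorem AdaptedAt.sub (hY : HasFaceCharts n Y) (hf : AdaptedAt g Y f x) (hk : AdaptedAt g Y k x) :
    AdaptedAt g Y (fun y => f y - k y) x := by
  have h := hf.add hY (hk.const_mul hY (-1))
  refine h.congr hY (Eventually.of_forall fun y => ?_)
  ring

theorem AdaptedAt.sub_const (hY : HasFaceCharts n Y) (hf : AdaptedAt g Y f x) (c : ℝ) :
    AdaptedAt g Y (fun y => f y - c) x := hf.sub hY (adaptedAt_const hY c)

theorem AdaptedAt.sum (hY : HasFaceCharts n Y) {ι : Type*} (s : Finset ι) {f : ι → Ω → ℝ}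
    (hf : ∀ i ∈ s, AdaptedAt g Y (f i) x) : AdaptedAt g Y (fun y => ∑ i ∈ s, f i y) x := by
  classical
  induction s using Finset.induction_on with
  | empty => simpa using adaptedAt_const hY 0
  | insert a s ha ih =>
    simp only [Finset.sum_insert ha]
    exact (hf a (by simp)).add hY (ih fun i hi => hf i (by simp [hi]))

theorem adaptedAt_of_notMem (h : x ∉ Y) (hf : SmoothAt n f x) : AdaptedAt g Y f x :=
  ⟨hf, fun hx => absurd hx h⟩

/-- Near a point of `Y = {ρ = 0}`, every smooth function becomes adapted after subtraction of a
suitable multiple of `ρ`. -/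
theorem exists_adaptedAt_sub_mul {φ : OpenPartialHomeomorph Ω (EuclideanQuadrant (n + 1))}
    {a : Fin (n + 1)} {y : Ω} (hφ : IsSmoothChartAt φ y) (ha : IsFaceIn Y φ a)
    (hk : ∀ᶠ x in 𝓝 y, SmoothAt n k x) :
    ∃ w : Ω → ℝ, (∀ᶠ x in 𝓝 y, SmoothAt n w x) ∧
      ∀ᶠ x in 𝓝 y, AdaptedAt g Y (fun x => k x - (φ x).1 a * w x) x := by
  let ρ : Ω → ℝ := fun x => (φ x).1 a
  have hw : ∀ᶠ x in 𝓝 y, SmoothAt n (fun x => gradProd g ρ k x * (gradProd g ρ ρ x)⁻¹) x := by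
    filter_upwards [hk, φ.open_source.mem_nhds hφ.2] with x hkx hx
    have hφx : IsSmoothChartAt φ x := ⟨hφ.1, hx⟩
    have h1 : SmoothAt n ρ x := hφx.smoothAt_coord a
    refine ContMDiffAt.mul (h1.gradProd hkx) ?_
    have h2 := (gradProd_self_pos (g := g) (hφx.coord_notMem_criticalSet a)).ne'
    exact ((contDiffAt_inv ℝ h2).contMDiffAt).comp x (h1.gradProd h1)
  refine ⟨_, hw, ?_⟩
  filter_upwards [hw, hk, φ.open_source.mem_nhds hφ.2] with x hwx hkx hx
  have hφx : IsSmoothChartAt φ x := ⟨hφ.1, hx⟩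
  have h1 : SmoothAt n ρ x := hφx.smoothAt_coord a
  have h3 : SmoothAt n (fun x => ρ x * (gradProd g ρ k x * (gradProd g ρ ρ x)⁻¹)) x :=
    ContMDiffAt.mul h1 hwx
  refine ⟨ContMDiffAt.sub hkx h3, fun hxY => ?_⟩
  have h2 := (gradProd_self_pos (g := g) (hφx.coord_notMem_criticalSet a)).ne'
  have h4 : ρ x = 0 := (ha x hx).1 hxY
  rw [isTangentTo_gradient_iff hφx hxY ha, gradProd_comm]
  change gradProd g ρ (fun x => k x - ρ x * (gradProd g ρ k x * (gradProd g ρ ρ x)⁻¹)) x = 0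
  rw [gradProd_sub hkx h3, gradProd_mul h1 hwx, h4]
  change gradProd g ρ ρ x ≠ 0 at h2
  field_simp
  ring

/-- Along `Y` the square of a defining function of `Y` has gradient zero. -/
theorem adaptedAt_coord_sq {φ : OpenPartialHomeomorph Ω (EuclideanQuadrant (n + 1))}
    {a : Fin (n + 1)} (hφ : IsSmoothChartAt φ x) (ha : IsFaceIn Y φ a) :
    AdaptedAt g Y (fun z => (φ z).1 a ^ 2) x := by
  refine ⟨(hφ.smoothAt_coord a).comp_real (θ := fun t => t ^ 2) (by fun_prop), fun hxY => ?_⟩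
  rw [isTangentTo_gradient_iff hφ hxY ha, gradProd_comm,
    gradProd_comp (θ := fun t => t ^ 2) (by fun_prop) (hφ.smoothAt_coord a)]
  have : (φ x).1 a = 0 := (ha x hφ.2).1 hxY
  simp [this]

/-- An adapted function which vanishes at a given point and is positive at the other points near
it. It plays the role of the square of the distance. -/
theorem exists_adaptedAt_isolated_zero (hY : HasFaceCharts n Y) (hYc : IsClosed Y) (x₀ : Ω) :
    ∃ D : Ω → ℝ, D x₀ = 0 ∧
      ∀ᶠ x in 𝓝 x₀, AdaptedAt g Y D x ∧ 0 ≤ D x ∧ (D x = 0 → x = x₀) := by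
  by_cases hx₀ : x₀ ∈ Y
  · obtain ⟨φ, a, hφ, ha⟩ := hY x₀ hx₀
    have hs : ∀ᶠ x in 𝓝 x₀, IsSmoothChartAt φ x := by
      filter_upwards [φ.open_source.mem_nhds hφ.2] with x hx using ⟨hφ.1, hx⟩
    have hρ₀ : (φ x₀).1 a = 0 := (ha x₀ hφ.2).1 hx₀
    have h1 : ∀ i : Fin (n + 1), ∃ w : Ω → ℝ, ∀ᶠ x in 𝓝 x₀,
        AdaptedAt g Y (fun x => (φ x).1 i - (φ x).1 a * w x) x := fun i => by
      obtain ⟨w, -, hw⟩ := exists_adaptedAt_sub_mul (g := g) (k := fun x => (φ x).1 i) hφ ha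
        (hs.mono fun x hx => hx.smoothAt_coord i)
      exact ⟨w, hw⟩
    choose w hw using h1
    refine ⟨fun x => ∑ i, ((φ x).1 i - (φ x).1 a * w i x - (φ x₀).1 i) ^ 2 + ((φ x).1 a) ^ 2,
      by simp [hρ₀], ?_⟩
    filter_upwards [eventually_all.2 hw, hs] with x hx hφx
    have hnn : ∀ i ∈ Finset.univ, 0 ≤ ((φ x).1 i - (φ x).1 a * w i x - (φ x₀).1 i) ^ 2 :=
      fun i _ => sq_nonneg _
    refine ⟨?_, by positivity, fun h0 => ?_⟩
    · refine AdaptedAt.add hY (AdaptedAt.sum hY _ fun i _ => ?_) ?_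
      · exact ((hx i).sub_const hY _).comp hY (θ := fun t => t ^ 2) (by fun_prop)
      · exact adaptedAt_coord_sq hφx ha
    · have h2 := (add_eq_zero_iff_of_nonneg (Finset.sum_nonneg hnn) (sq_nonneg _)).1 h0
      have h3 : (φ x).1 a = 0 := by simpa using h2.2
      refine φ.injOn hφx.2 hφ.2 (Subtype.ext ?_)
      ext i
      have h4 := (Finset.sum_eq_zero_iff_of_nonneg hnn).1 h2.1 i (Finset.mem_univ i)
      rw [h3] at h4
      have h5 : (φ x).1 i - 0 * w i x - (φ x₀).1 i = 0 := by simpa using h4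
      linarith
  · let φ := chartAt (EuclideanQuadrant (n + 1)) x₀
    have hφ : IsSmoothChartAt φ x₀ :=
      ⟨IsManifold.chart_mem_maximalAtlas x₀, mem_chart_source _ x₀⟩
    refine ⟨fun x => ∑ i, ((φ x).1 i - (φ x₀).1 i) ^ 2, by simp, ?_⟩
    filter_upwards [φ.open_source.mem_nhds hφ.2, hYc.isOpen_compl.mem_nhds hx₀] with x hx hxY
    have hφx : IsSmoothChartAt φ x := ⟨hφ.1, hx⟩
    have hnn : ∀ i ∈ Finset.univ, 0 ≤ ((φ x).1 i - (φ x₀).1 i) ^ 2 := fun i _ => sq_nonneg _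
    refine ⟨AdaptedAt.sum hY _ fun i _ => ?_, Finset.sum_nonneg hnn, fun h0 => ?_⟩
    · exact ((adaptedAt_of_notMem hxY (hφx.smoothAt_coord i)).sub_const hY _).comp hY
        (θ := fun t => t ^ 2) (by fun_prop)
    · refine φ.injOn hx hφ.2 (Subtype.ext ?_)
      ext i
      have h4 := (Finset.sum_eq_zero_iff_of_nonneg hnn).1 h0 i (Finset.mem_univ i)
      have h5 : (φ x).1 i - (φ x₀).1 i = 0 := by simpa using h4
      linarith

variable [T2Space Ω] [CompactSpace Ω]

theorem exists_adaptedAt_bump (hY : HasFaceCharts n Y) (hYc : IsClosed Y) {x₀ : Ω} {O : Set Ω}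
    (hO : O ∈ 𝓝 x₀) :
    ∃ χ : Ω → ℝ, (∀ x, AdaptedAt g Y χ x) ∧ (∀ x, 0 ≤ χ x) ∧ 0 < χ x₀ ∧ tsupport χ ⊆ O := by
  obtain ⟨D, hD₀, hD⟩ := exists_adaptedAt_isolated_zero (g := g) hY hYc x₀
  obtain ⟨C, ⟨hC, hCc⟩, hCO⟩ := (closed_nhds_basis x₀).mem_iff.1 (inter_mem hO hD)
  set V := interior C with hV
  have hxV : x₀ ∈ V := mem_interior_iff_mem_nhds.2 hC
  have hVC : closure V ⊆ C := closure_minimal interior_subset hCc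
  have hpos : ∀ x ∈ frontier V, 0 < D x := by
    intro x hx
    have h1 := (hCO (hVC hx.1)).2
    refine lt_of_le_of_ne h1.2.1 fun h0 => ?_
    rw [h1.2.2 h0.symm] at hx
    exact hx.2 (by rwa [hV, interior_interior])
  obtain ⟨d, hd0, hd⟩ := isClosed_frontier.isCompact.exists_forall_le'
    (fun x hx => (hCO (hVC hx.1)).2.1.continuousAt.continuousWithinAt) hpos
  let θ : ℝ → ℝ := fun t => 1 - Real.smoothTransition (2 * t / d)
  have hθ : ContDiff ℝ ∞ θ := by
    refine contDiff_const.sub (Real.smoothTransition.contDiff.comp ?_)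
    fun_prop
  have hθ0 : ∀ t, d / 2 ≤ t → θ t = 0 := by
    intro t ht
    have : 1 ≤ 2 * t / d := by rw [le_div_iff₀ hd0]; linarith
    simp [θ, Real.smoothTransition.one_of_one_le this]
  refine ⟨V.indicator fun x => θ (D x), fun x => ?_, fun x => ?_, ?_, ?_⟩
  · by_cases hx : x ∈ V
    · refine ((hCO (interior_subset hx)).2.1.comp hY hθ).congr hY ?_
      filter_upwards [isOpen_interior.mem_nhds hx] with z hz
      exact indicator_of_mem hz _
    · refine (adaptedAt_const hY 0).congr hY ?_
      by_cases hx' : x ∈ closure V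
      · have hxf : x ∈ frontier V := ⟨hx', by rwa [hV, interior_interior]⟩
        have h2 := (hCO (hVC hx')).2.1.continuousAt.eventually
          (lt_mem_nhds (show d / 2 < D x by linarith [hd x hxf]))
        filter_upwards [h2] with z hz
        by_cases hzV : z ∈ V
        · rw [indicator_of_mem hzV, hθ0 _ hz.le]
        · exact indicator_of_notMem hzV _
      · filter_upwards [isClosed_closure.isOpen_compl.mem_nhds hx'] with z hz
        exact indicator_of_notMem (fun h => hz (subset_closure h)) _
  · exact indicator_nonneg (fun z _ => sub_nonneg.2 (Real.smoothTransition.le_one _)) x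
  · rw [indicator_of_mem hxV, hD₀]
    simp [θ]
  · exact (closure_mono (support_indicator_subset)).trans (hVC.trans fun z hz => (hCO hz).1)

/-- Adapted cutoff functions. -/
theorem exists_adaptedAt_cutoff (hY : HasFaceCharts n Y) (hYc : IsClosed Y) {A O : Set Ω}
    (hA : IsClosed A) (hO : IsOpen O) (hAO : A ⊆ O) :
    ∃ χ : Ω → ℝ, (∀ x, AdaptedAt g Y χ x) ∧ (∀ x, 0 ≤ χ x) ∧
      (∀ x ∈ A, χ =ᶠ[𝓝 x] fun _ => 1) ∧ tsupport χ ⊆ O := by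
  have h1 : ∀ x : A, ∃ χ : Ω → ℝ, (∀ x, AdaptedAt g Y χ x) ∧ (∀ x, 0 ≤ χ x) ∧ 0 < χ x ∧
      tsupport χ ⊆ O := fun x => exists_adaptedAt_bump hY hYc (hO.mem_nhds (hAO x.2))
  choose c hc hc0 hcx hcO using h1
  obtain ⟨t, ht⟩ := hA.isCompact.elim_finite_subcover (fun x : A => {z | 0 < c x z})
    (fun x => isOpen_lt continuous_const
      (continuous_iff_continuousAt.2 fun z => (hc x z).continuousAt))
    (fun x hx => mem_iUnion.2 ⟨⟨x, hx⟩, hcx ⟨x, hx⟩⟩)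
  let s : Ω → ℝ := fun z => ∑ i ∈ t, c i z
  have hs : ∀ z, AdaptedAt g Y s z := fun z => AdaptedAt.sum hY _ fun i _ => hc i z
  have hscont : Continuous s := continuous_iff_continuousAt.2 fun z => (hs z).continuousAt
  have hspos : ∀ z ∈ A, 0 < s z := by
    intro z hz
    obtain ⟨i, hi, hzi⟩ := mem_iUnion₂.1 (ht hz)
    exact Finset.sum_pos' (fun j _ => hc0 j z) ⟨i, hi, hzi⟩
  obtain ⟨m, hm0, hm⟩ := hA.isCompact.exists_forall_le' hscont.continuousOn hspos
  have hθ : ContDiff ℝ ∞ fun t : ℝ => Real.smoothTransition (2 * t / m) :=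
    Real.smoothTransition.contDiff.comp (by fun_prop)
  refine ⟨fun z => Real.smoothTransition (2 * s z / m), fun z => (hs z).comp hY hθ,
    fun z => Real.smoothTransition.nonneg _, fun z hz => ?_, ?_⟩
  · filter_upwards [hscont.continuousAt.eventually
      (lt_mem_nhds (show m / 2 < s z by linarith [hm z hz]))] with w hw
    refine Real.smoothTransition.one_of_one_le ?_
    rw [le_div_iff₀ hm0]
    linarith
  · have h2 : Function.support (fun z => Real.smoothTransition (2 * s z / m)) ⊆
        ⋃ i ∈ t, tsupport (c i) := by
      intro z hz
      by_contra h3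
      refine hz ?_
      have h4 : s z = 0 := Finset.sum_eq_zero fun i hi => by
        by_contra h5
        exact h3 (mem_iUnion₂.2 ⟨i, hi, subset_tsupport _ h5⟩)
      simp [h4]
    refine (closure_minimal h2 ?_).trans (iUnion₂_subset fun i _ => hcO i)
    exact t.finite_toSet.isClosed_biUnion fun i _ => isClosed_tsupport _

end Adapted

/-! ### The preorder of the ascending functions -/

section Order

variable {n : ℕ} {Ω : Type*} [TopologicalSpace Ω] [ChartedSpace (EuclideanQuadrant (n + 1)) Ω]
  [IsManifold (cornerModel n) ∞ Ω] {g : Metric n Ω} {Y : Set Ω} {F f k u : Ω → ℝ} {x y z : Ω}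

theorem continuous_of_adaptedAt (hf : ∀ x, AdaptedAt g Y f x) : Continuous f :=
  continuous_iff_continuousAt.2 fun x => (hf x).continuousAt

theorem continuous_gradProd (hf : ∀ x, AdaptedAt g Y f x) (hk : ∀ x, AdaptedAt g Y k x) :
    Continuous (gradProd g f k) :=
  continuous_iff_continuousAt.2 fun x =>
    ContMDiffAt.continuousAt ((hf x).smoothAt.gradProd (hk x).smoothAt)

/-- `f` is smooth, its gradient is tangent to `Y` along `Y`, and it does not decrease along the
trajectories of `∇F`. -/
def IsAscending (g : Metric n Ω) (Y : Set Ω) (F f : Ω → ℝ) : Prop :=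
  ∀ x, AdaptedAt g Y f x ∧ 0 ≤ gradProd g F f x

/-- The preorder defined by the ascending functions: `x` is below `y` if no ascending function is
larger at `x` than at `y`. -/
def Below (g : Metric n Ω) (Y : Set Ω) (F : Ω → ℝ) (x y : Ω) : Prop :=
  ∀ f, IsAscending g Y F f → f x ≤ f y

theorem Below.refl (x : Ω) : Below g Y F x x := fun _ _ => le_rfl

theorem Below.trans (h : Below g Y F x y) (h' : Below g Y F y z) : Below g Y F x z :=
  fun f hf => (h f hf).trans (h' f hf)

theorem IsAscending.continuous (hf : IsAscending g Y F f) : Continuous f :=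
  continuous_of_adaptedAt fun x => (hf x).1

theorem isClosed_below : IsClosed {p : Ω × Ω | Below g Y F p.1 p.2} := by
  simp only [Below, ofPred_forall]
  exact isClosed_iInter fun f => isClosed_iInter fun hf =>
    isClosed_le (hf.continuous.comp continuous_fst) (hf.continuous.comp continuous_snd)

theorem isAscending_self (hF : ∀ x, AdaptedAt g Y F x) : IsAscending g Y F F :=
  fun x => ⟨hF x, gradProd_self_nonneg⟩

theorem IsAscending.mul (hY : HasFaceCharts n Y) (hf : IsAscending g Y F f)
    (hk : IsAscending g Y F k) (hf0 : ∀ x, 0 ≤ f x) (hk0 : ∀ x, 0 ≤ k x) :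
    IsAscending g Y F fun x => f x * k x := by
  refine fun x => ⟨(hf x).1.mul hY (hk x).1, ?_⟩
  rw [gradProd_mul (hf x).1.1 (hk x).1.1]
  exact add_nonneg (mul_nonneg (hf0 x) (hk x).2) (mul_nonneg (hk0 x) (hf x).2)

theorem IsAscending.comp (hY : HasFaceCharts n Y) (hf : IsAscending g Y F f) {θ : ℝ → ℝ}
    (hθ : ContDiff ℝ ∞ θ) (hmono : Monotone θ) : IsAscending g Y F fun x => θ (f x) := by
  refine fun x => ⟨(hf x).1.comp hY hθ, ?_⟩
  rw [gradProd_comp (hθ.differentiable (by simp)) (hf x).1.1]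
  exact mul_nonneg hmono.deriv_nonneg (hf x).2

theorem IsAscending.sum (hY : HasFaceCharts n Y) {ι : Type*} (s : Finset ι) {f : ι → Ω → ℝ}
    (hf : ∀ i ∈ s, IsAscending g Y F (f i)) : IsAscending g Y F fun x => ∑ i ∈ s, f i x := by
  refine fun x => ⟨AdaptedAt.sum hY s fun i hi => (hf i hi x).1, ?_⟩
  rw [gradProd_sum s fun i hi => (hf i hi x).1.1]
  exact Finset.sum_nonneg fun i hi => (hf i hi x).2

theorem IsAscending.prod (hY : HasFaceCharts n Y) {ι : Type*} (s : Finset ι) {f : ι → Ω → ℝ}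
    (hf : ∀ i ∈ s, IsAscending g Y F (f i)) (hf0 : ∀ i ∈ s, ∀ x, 0 ≤ f i x) :
    IsAscending g Y F fun x => ∏ i ∈ s, f i x := by
  classical
  induction s using Finset.induction_on with
  | empty =>
    simp only [Finset.prod_empty]
    exact fun x => ⟨adaptedAt_const hY 1, by rw [gradProd_const]⟩
  | insert a s ha ih =>
    simp only [Finset.prod_insert ha]
    exact (hf a (by simp)).mul hY (ih (fun i hi => hf i (by simp [hi]))
      fun i hi => hf0 i (by simp [hi])) (hf0 a (by simp))
      fun x => Finset.prod_nonneg fun i hi => hf0 i (by simp [hi]) x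

/-- If `x` is not below `y`, this is witnessed by an ascending function which is locally constant
near both points. -/
theorem exists_isAscending_of_not_below (hY : HasFaceCharts n Y) (h : ¬ Below g Y F x y) :
    ∃ f, IsAscending g Y F f ∧ (∀ z, 0 ≤ f z) ∧ (f =ᶠ[𝓝 x] fun _ => 1) ∧
      (f =ᶠ[𝓝 y] fun _ => 0) := by
  obtain ⟨f, hf, hxy⟩ : ∃ f, IsAscending g Y F f ∧ f y < f x := by
    simpa [Below] using h
  have hd : 0 < f x - f y := sub_pos.2 hxy
  let θ : ℝ → ℝ := fun t => Real.smoothTransition (3 * (t - f y) / (f x - f y) - 1)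
  refine ⟨fun z => θ (f z), hf.comp hY (Real.smoothTransition.contDiff.comp (by fun_prop)) ?_,
    fun z => Real.smoothTransition.nonneg _, ?_, ?_⟩
  · refine Real.smoothTransition.monotone.comp fun s t hst => ?_
    gcongr
  · filter_upwards [hf.continuous.continuousAt.eventually
      (lt_mem_nhds (show f y + 2 * (f x - f y) / 3 < f x by linarith))] with z hz
    refine Real.smoothTransition.one_of_one_le ?_
    rw [le_sub_iff_add_le, le_div_iff₀ hd]
    linarith
  · filter_upwards [hf.continuous.continuousAt.eventually
      (gt_mem_nhds (show f y < f y + (f x - f y) / 3 by linarith))] with z hz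
    refine Real.smoothTransition.zero_of_nonpos ?_
    rw [sub_nonpos, div_le_one hd]
    linarith

theorem exists_isAscending_pos (hY : HasFaceCharts n Y) {A : Set Ω} (hA : IsCompact A)
    (h : ∀ z ∈ A, ¬ Below g Y F z y) :
    ∃ f, IsAscending g Y F f ∧ (∀ z, 0 ≤ f z) ∧ (∀ z ∈ A, 0 < f z) ∧ f y = 0 := by
  choose! c hc hc0 hcz hcy using fun z hz => exists_isAscending_of_not_below hY (h z hz)
  obtain ⟨t, htA, ht⟩ := hA.elim_nhds_subcover (fun z => {w | c z w = 1}) hcz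
  refine ⟨fun w => ∑ i ∈ t, c i w, IsAscending.sum hY t fun i hi => hc i (htA i hi),
    fun w => Finset.sum_nonneg fun i hi => hc0 i (htA i hi) w, fun w hw => ?_,
    Finset.sum_eq_zero fun i hi => (hcy i (htA i hi)).self_of_nhds⟩
  obtain ⟨i, hi, hwi⟩ := mem_iUnion₂.1 (ht hw)
  refine Finset.sum_pos' (fun j hj => hc0 j (htA j hj) w) ⟨i, hi, ?_⟩
  rw [show c i w = 1 from hwi]
  exact one_pos

theorem exists_isAscending_eq_zero (hY : HasFaceCharts n Y) {A : Set Ω} (hA : IsCompact A)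
    (h : ∀ z ∈ A, ¬ Below g Y F x z) :
    ∃ f, IsAscending g Y F f ∧ (∀ z, 0 ≤ f z) ∧ f x = 1 ∧ ∀ z ∈ A, f =ᶠ[𝓝 z] fun _ => 0 := by
  choose! c hc hc0 hcx hcz using fun z hz => exists_isAscending_of_not_below hY (h z hz)
  obtain ⟨t, htA, ht⟩ := hA.elim_nhds_subcover (fun z => {w | c z =ᶠ[𝓝 w] fun _ => 0})
    fun z hz => eventually_eventually_nhds.2 (hcz z hz)
  refine ⟨fun w => ∏ i ∈ t, c i w,
    IsAscending.prod hY t (fun i hi => hc i (htA i hi)) fun i hi => hc0 i (htA i hi),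
    fun w => Finset.prod_nonneg fun i hi => hc0 i (htA i hi) w,
    Finset.prod_eq_one fun i hi => (hcx i (htA i hi)).self_of_nhds, fun w hw => ?_⟩
  obtain ⟨i, hi, hwi⟩ := mem_iUnion₂.1 (ht hw)
  filter_upwards [hwi] with v hv
  exact Finset.prod_eq_zero hi hv

/-- The square of the distance to a non-critical point may be replaced by an adapted function, whose
derivative along `∇F` is bounded by a multiple of that of `F`. -/
theorem exists_gradProd_le_mul (hY : HasFaceCharts n Y) (hYc : IsClosed Y)
    (hF : ∀ x, AdaptedAt g Y F x) (hx : x ∉ criticalSet n F) :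
    ∃ (D : Ω → ℝ) (L : ℝ), 0 < L ∧ D x = 0 ∧ ∀ᶠ z in 𝓝 x, AdaptedAt g Y D z ∧ 0 ≤ D z ∧
      (D z = 0 → z = x) ∧ gradProd g F D z ≤ L * gradProd g F F z := by
  obtain ⟨D, hDx, hD⟩ := exists_adaptedAt_isolated_zero (g := g) hY hYc x
  have h0 : 0 < gradProd g F F x := gradProd_self_pos hx
  have hDx' := hD.self_of_nhds.1
  refine ⟨D, (|gradProd g F D x| + 1) / gradProd g F F x, by positivity, hDx, ?_⟩
  have h1 : gradProd g F D x <
      (|gradProd g F D x| + 1) / gradProd g F F x * gradProd g F F x := by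
    rw [div_mul_cancel₀ _ h0.ne']
    linarith [le_abs_self (gradProd g F D x)]
  have h2 : ContinuousAt (gradProd g F D) x :=
    ContMDiffAt.continuousAt ((hF x).1.gradProd hDx'.1)
  have h3 : ContinuousAt (fun z => (|gradProd g F D x| + 1) / gradProd g F F x *
      gradProd g F F z) x := (continuous_gradProd hF hF).continuousAt.const_mul _
  filter_upwards [hD, h2.eventually_lt h3 h1] with z hz hz2
  exact ⟨hz.1, hz.2.1, hz.2.2, hz2.le⟩

variable [T2Space Ω] [CompactSpace Ω]

/-- A function `f` which ascends only on an open set `B` prevents `x ∈ B` from being below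
`y ∉ B`, provided that on the frontier of `B` it vanishes outside of the points which are already
known not to be below `y`: after a cutoff, the decrease of `f` close to the frontier is compensated
by functions which ascend strictly there. -/
theorem not_below_of_local (hY : HasFaceCharts n Y) (hYc : IsClosed Y)
    (hF : ∀ x, AdaptedAt g Y F x) (hF0 : ∀ x, 0 ≤ F x) {B : Set Ω} (hB : IsOpen B)
    (hx : x ∈ B) (hy : y ∉ B) (hcrit : ∀ z ∈ frontier B, z ∉ criticalSet n F)
    (hf : ∀ z ∈ B, AdaptedAt g Y f z ∧ 0 ≤ gradProd g F f z)
    (hfx : 0 < f x) (hfr : ∀ z ∈ frontier B, (f =ᶠ[𝓝 z] fun _ => 0) ∨ ¬ Below g Y F z y) :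
    ¬ Below g Y F x y := by
  set Z : Set Ω := {z | f =ᶠ[𝓝 z] fun _ => 0} with hZ
  have hZo : IsOpen Z := isOpen_setOfPred_eventually_nhds
  obtain ⟨h, hh, hh0, hhpos, hhy⟩ := exists_isAscending_pos (g := g) (F := F) (y := y) hY
    (isClosed_frontier.isCompact.inter_right hZo.isClosed_compl)
    (fun z hz => (hfr z hz.1).resolve_left hz.2)
  set W : Set Ω := {z | 0 < h z * gradProd g F F z} with hW
  have hFF : Continuous (gradProd g F F) := continuous_gradProd hF hF
  have hq : Continuous fun z => h z * gradProd g F F z := hh.continuous.mul hFF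
  have hWo : IsOpen W := isOpen_lt continuous_const hq
  have hAB : closure B \ (Z ∪ W) ∪ {x} ⊆ B := by
    rintro z (⟨hz, hzZW⟩ | rfl)
    · by_contra hzB
      have hzf : z ∈ frontier B := ⟨hz, by rwa [hB.interior_eq]⟩
      refine hzZW ?_
      by_cases hzZ : z ∈ Z
      · exact Or.inl hzZ
      · exact Or.inr (mul_pos (hhpos z ⟨hzf, hzZ⟩) (gradProd_self_pos (hcrit z hzf)))
    · exact hx
  obtain ⟨χ, hχ, hχ0, hχ1, hχB⟩ := exists_adaptedAt_cutoff (g := g) hY hYc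
    ((isClosed_closure.sdiff (hZo.union hWo)).union isClosed_singleton) hB hAB
  have hχout : ∀ z, z ∉ tsupport χ → χ =ᶠ[𝓝 z] fun _ => 0 := fun z hz =>
    notMem_tsupport_iff_eventuallyEq.1 hz
  -- the part of the derivative of `χ f` which may be negative
  let e : Ω → ℝ := fun z => f z * gradProd g F χ z
  have hTχ : closure {z | e z ≠ 0} ⊆ tsupport χ := by
    refine closure_minimal (fun z hz => ?_) (isClosed_tsupport χ)
    by_contra hzs
    exact hz (by simp [e, gradProd_congr (hχout z hzs), gradProd_const])
  have hTW : closure {z | e z ≠ 0} ⊆ W := by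
    intro z hz
    have hzB : z ∈ B := hχB (hTχ hz)
    have hne : ¬ ∀ᶠ w in 𝓝 z, e w = 0 := fun h0 => by
      obtain ⟨w, hw, hw0⟩ := mem_closure_iff_frequently.1 hz |>.and_eventually h0 |>.exists
      exact hw hw0
    have hzZ : z ∉ Z := fun hzZ => hne (by
      filter_upwards [hzZ] with w hw
      simp [e, hw])
    have hzA : z ∉ closure B \ (Z ∪ W) ∪ {x} := fun hzA => hne (by
      filter_upwards [eventually_eventually_nhds.2 (hχ1 z hzA)] with w hw
      have : gradProd g F χ w = 0 := by rw [gradProd_congr hw, gradProd_const]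
      simp [e, this])
    by_contra hzW
    exact hzA (Or.inl ⟨subset_closure hzB, by simp [hzZ, hzW]⟩)
  have hTc : IsCompact (closure {z | e z ≠ 0}) := isClosed_closure.isCompact
  obtain ⟨m, hm0, hm⟩ := hTc.exists_forall_le' hq.continuousOn (fun z hz => hTW hz)
  have hec : ContinuousOn e (closure {z | e z ≠ 0}) := fun z hz =>
    ((hf z (hχB (hTχ hz))).1.continuousAt.mul
      (continuous_gradProd hF hχ).continuousAt).continuousWithinAt
  obtain ⟨M, hM⟩ := hTc.exists_bound_of_continuousOn hec
  -- the compensating term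
  let N : ℝ := |M| / m
  have hN : 0 ≤ N := by positivity
  have h1F : IsAscending g Y F fun z => 1 + F z := fun z =>
    ⟨(adaptedAt_const hY 1).add hY (hF z), by
      rw [gradProd_add contMDiffAt_const (hF z).1, gradProd_const, zero_add]
      exact gradProd_self_nonneg⟩
  have hcomp : ∀ z, AdaptedAt g Y (fun z => N * (h z * (1 + F z))) z := fun z =>
    ((hh z).1.mul hY (h1F z).1).const_mul hY N
  have hcut : ∀ z, AdaptedAt g Y (fun z => χ z * f z) z ∧ e z ≤ gradProd g F (fun z => χ z * f z) z
      := by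
    intro z
    by_cases hz : z ∈ tsupport χ
    · have hfz := hf z (hχB hz)
      refine ⟨(hχ z).mul hY hfz.1, ?_⟩
      rw [gradProd_mul (hχ z).1 hfz.1.1]
      exact le_add_of_nonneg_left (mul_nonneg (hχ0 z) hfz.2)
    · have h0 : (fun z => χ z * f z) =ᶠ[𝓝 z] fun _ => 0 := by
        filter_upwards [hχout z hz] with w hw
        simp [hw]
      refine ⟨(adaptedAt_const hY 0).congr hY h0, ?_⟩
      rw [gradProd_congr h0, gradProd_const]
      simp [e, gradProd_congr (hχout z hz), gradProd_const]
  have hk : IsAscending g Y F fun z => N * (h z * (1 + F z)) + χ z * f z := by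
    refine fun z => ⟨(hcomp z).add hY (hcut z).1, ?_⟩
    rw [gradProd_add (hcomp z).1 (hcut z).1.1,
      gradProd_const_mul N (((hh z).1.mul hY (h1F z).1).1), gradProd_mul (hh z).1.1 (h1F z).1.1,
      gradProd_add contMDiffAt_const (hF z).1, gradProd_const, zero_add]
    have h2 : 0 ≤ N * ((1 + F z) * gradProd g F h z) :=
      mul_nonneg hN (mul_nonneg (by linarith [hF0 z]) (hh z).2)
    have h3 := (hcut z).2
    have h4 : 0 ≤ N * (h z * gradProd g F F z) + e z := by
      by_cases hz : e z = 0
      · rw [hz, add_zero]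
        exact mul_nonneg hN (mul_nonneg (hh0 z) gradProd_self_nonneg)
      · have hzT : z ∈ closure {z | e z ≠ 0} := subset_closure hz
        have h5 := hM z hzT
        rw [Real.norm_eq_abs] at h5
        have h6 : N * m ≤ N * (h z * gradProd g F F z) := mul_le_mul_of_nonneg_left (hm z hzT) hN
        have h7 : N * m = |M| := by simp only [N]; field_simp
        linarith [neg_abs_le (e z), le_abs_self M]
    linarith
  intro hbelow
  have h8 := hbelow _ hk
  have hχy : χ y = 0 := by
    by_contra hne
    exact hy (hχB (subset_tsupport _ hne))
  have hχx : χ x = 1 := (hχ1 x (Or.inr rfl)).self_of_nhds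
  have h9 : 0 ≤ N * (h x * (1 + F x)) :=
    mul_nonneg hN (mul_nonneg (hh0 x) (by linarith [hF0 x]))
  rw [hhy, hχy, hχx] at h8
  linarith

/-- A relation `x ≤ y` passes through the frontier of every neighbourhood of `x`. -/
theorem Below.exists_mem_frontier (hY : HasFaceCharts n Y) (hYc : IsClosed Y)
    (hF : ∀ x, AdaptedAt g Y F x) (hF0 : ∀ x, 0 ≤ F x) (h : Below g Y F x y) {B : Set Ω}
    (hB : IsOpen B) (hx : x ∈ B) (hy : y ∉ B) (hcrit : ∀ z ∈ frontier B, z ∉ criticalSet n F) :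
    ∃ z ∈ frontier B, Below g Y F x z ∧ Below g Y F z y := by
  by_contra! hno
  have hcl : IsClosed {z | Below g Y F z y} :=
    isClosed_below.preimage (by fun_prop : Continuous fun z : Ω => (z, y))
  obtain ⟨f, hf, -, hfx, hfA⟩ := exists_isAscending_eq_zero (g := g) (F := F) (x := x) hY
    (isClosed_frontier.isCompact.inter_right hcl) (fun z hz hxz => hno z hz.1 hxz hz.2)
  refine not_below_of_local hY hYc hF hF0 hB hx hy hcrit (fun z _ => hf z)
    (by rw [hfx]; exact one_pos) (fun z hz => ?_) h
  by_cases hzy : Below g Y F z y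
  · exact Or.inl (hfA z ⟨hz, hzy⟩)
  · exact Or.inr hzy

/-- The order is dense: between two distinct comparable points there is a third one, arbitrarily
close to the lower one and not critical. -/
theorem Below.exists_between (hY : HasFaceCharts n Y) (hYc : IsClosed Y)
    (hF : ∀ x, AdaptedAt g Y F x) (hF0 : ∀ x, 0 ≤ F x) (hfin : (criticalSet n F).Finite)
    (h : Below g Y F x y) (hxy : x ≠ y) {O : Set Ω} (hO : O ∈ 𝓝 x) :
    ∃ z ∈ O, z ≠ x ∧ z ≠ y ∧ z ∉ criticalSet n F ∧ Below g Y F x z ∧ Below g Y F z y := by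
  have hS : IsClosed (insert y (criticalSet n F) \ {x}) :=
    ((hfin.insert y).subset sdiff_subset).isClosed
  have hxS : x ∉ insert y (criticalSet n F) \ {x} := fun hx => hx.2 rfl
  obtain ⟨C, ⟨hC, hCc⟩, hCO⟩ := (closed_nhds_basis x).mem_iff.1
    (inter_mem hO (hS.isOpen_compl.mem_nhds hxS))
  have hfr : ∀ z ∈ frontier (interior C), z ∈ O ∧ z ≠ x ∧ z ≠ y ∧ z ∉ criticalSet n F := by
    intro z hz
    have hzC : z ∈ C := closure_minimal interior_subset hCc hz.1
    have hzx : z ≠ x := by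
      rintro rfl
      exact hz.2 (by rw [interior_interior]; exact mem_interior_iff_mem_nhds.2 hC)
    have h1 := hCO hzC
    refine ⟨h1.1, hzx, fun hzy => h1.2 ⟨Or.inl hzy, hzx⟩, fun hzc => h1.2 ⟨Or.inr hzc, hzx⟩⟩
  obtain ⟨z, hz, hxz, hzy⟩ := h.exists_mem_frontier hY hYc hF hF0 isOpen_interior
    (mem_interior_iff_mem_nhds.2 hC)
    (fun hy => (hCO (interior_subset hy)).2 ⟨Or.inl rfl, hxy.symm⟩) fun z hz => (hfr z hz).2.2.2
  obtain ⟨h1, h2, h3, h4⟩ := hfr z hz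
  exact ⟨z, h1, h2, h3, h4, hxz, hzy⟩

/-- The order is local near a non-critical point: functions which ascend near such a point respect
the order near it. For small `D`, the function `v = L F - D` ascends and a point which leaves a
neighbourhood `V` without decreasing `v` has to rise by a definite amount of `F`. -/
theorem exists_forall_le_of_below (hY : HasFaceCharts n Y) (hYc : IsClosed Y)
    (hF : ∀ x, AdaptedAt g Y F x) (hF0 : ∀ x, 0 ≤ F x) {x₀ : Ω} (hx₀ : x₀ ∉ criticalSet n F)
    (hu : ∀ᶠ z in 𝓝 x₀, AdaptedAt g Y u z ∧ 0 ≤ gradProd g F u z) :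
    ∃ N ∈ 𝓝 x₀, ∀ x ∈ N, ∀ z ∈ N, Below g Y F x z → u x ≤ u z := by
  obtain ⟨D, L, hL, hDx, hD⟩ := exists_gradProd_le_mul hY hYc hF hx₀
  have hFc : Continuous F := continuous_of_adaptedAt hF
  have hpos : ∀ᶠ z in 𝓝 x₀, 0 < gradProd g F F z :=
    (continuous_gradProd hF hF).continuousAt.eventually (lt_mem_nhds (gradProd_self_pos hx₀))
  obtain ⟨C, ⟨hC, hCc⟩, hCO⟩ := (closed_nhds_basis x₀).mem_iff.1 (hD.and (hu.and hpos))
  set V := interior C with hV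
  have hxV : x₀ ∈ V := mem_interior_iff_mem_nhds.2 hC
  have hVC : closure V ⊆ C := closure_minimal interior_subset hCc
  obtain ⟨d, hd0, hd⟩ := isClosed_frontier.isCompact.exists_forall_le'
    (fun x hx => (hCO (hVC hx.1)).1.1.continuousAt.continuousWithinAt)
    (fun x (hx : x ∈ frontier V) => show 0 < D x by
      have h1 := (hCO (hVC hx.1)).1
      refine lt_of_le_of_ne h1.2.1 fun h0 => ?_
      rw [h1.2.2.1 h0.symm] at hx
      exact hx.2 (by rwa [hV, interior_interior]))
  let v : Ω → ℝ := fun z => L * F z - D z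
  have hv : ∀ z ∈ C, AdaptedAt g Y v z ∧ 0 ≤ gradProd g F v z := by
    intro z hz
    have h1 := (hCO hz).1
    refine ⟨((hF z).const_mul hY L).sub hY h1.1, ?_⟩
    rw [gradProd_sub ((hF z).const_mul hY L).1 h1.1.1, gradProd_const_mul L (hF z).1]
    linarith [h1.2.2.2]
  set m := L * F x₀ - d / 2 with hm
  refine ⟨V ∩ {z | m < v z} ∩ {z | L * F z < L * F x₀ + d / 2}, ?_, ?_⟩
  · refine inter_mem (inter_mem (isOpen_interior.mem_nhds hxV) ?_) ?_
    · exact (hv x₀ (interior_subset hxV)).1.continuousAt.eventually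
        (lt_mem_nhds (by simp only [v, hDx]; linarith))
    · exact (hFc.continuousAt.const_mul L).eventually (gt_mem_nhds (by linarith))
  rintro x ⟨⟨hxV', hxm⟩, -⟩ z ⟨⟨hzV, -⟩, hzF⟩ hxz
  by_contra! hlt
  have huc : ContinuousOn u V := fun w hw =>
    (hCO (interior_subset hw)).2.1.1.continuousAt.continuousWithinAt
  have hB : IsOpen (V ∩ u ⁻¹' Ioi (u z)) := huc.isOpen_inter_preimage isOpen_interior isOpen_Ioi
  set B := V ∩ u ⁻¹' Ioi (u z) with hBdef
  have hBV : closure B ⊆ C := (closure_mono inter_subset_left).trans hVC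
  let m' := (u x + u z) / 2
  have hsm : ContDiff ℝ ∞ Real.smoothTransition := Real.smoothTransition.contDiff
  have hs : ∀ {w : Ω} {k : Ω → ℝ} (c : ℝ), AdaptedAt g Y k w ∧ 0 ≤ gradProd g F k w →
      AdaptedAt g Y (fun w => Real.smoothTransition (k w - c)) w ∧
        0 ≤ gradProd g F (fun w => Real.smoothTransition (k w - c)) w := by
    intro w k c hk
    refine ⟨(hk.1.sub_const hY c).comp hY hsm, ?_⟩
    rw [gradProd_comp (hsm.differentiable (by simp)) (hk.1.sub_const hY c).1,
      gradProd_sub_const c hk.1.1]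
    exact mul_nonneg Real.smoothTransition.monotone.deriv_nonneg hk.2
  refine not_below_of_local (B := B) hY hYc hF hF0
    (f := fun w => Real.smoothTransition (v w - m) * Real.smoothTransition (u w - m'))
    hB ⟨hxV', hlt⟩ (fun h => lt_irrefl (u z) h.2) ?_ ?_ ?_ ?_ hxz
  · intro w hw hwc
    have h1 := (hCO (hBV hw.1)).2.2
    rw [gradProd_of_mem_criticalSet hwc] at h1
    exact lt_irrefl _ h1
  · intro w hw
    have hwC : w ∈ C := hBV (subset_closure hw)
    have h1 := hs m (hv w hwC)
    have h2 := hs m' (hCO hwC).2.1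
    refine ⟨h1.1.mul hY h2.1, ?_⟩
    rw [gradProd_mul h1.1.1 h2.1.1]
    exact add_nonneg (mul_nonneg (Real.smoothTransition.nonneg _) h2.2)
      (mul_nonneg (Real.smoothTransition.nonneg _) h1.2)
  · refine mul_pos (Real.smoothTransition.pos_of_pos (sub_pos.2 hxm))
      (Real.smoothTransition.pos_of_pos (sub_pos.2 ?_))
    simp only [m']
    linarith
  · intro w hw
    have hwC : w ∈ C := hBV hw.1
    by_cases hwV : w ∈ V
    · left
      have h1 : u w ≤ u z := by
        by_contra! h2
        exact hw.2 (by rw [hB.interior_eq]; exact ⟨hwV, h2⟩)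
      filter_upwards [(hCO hwC).2.1.1.continuousAt.eventually
        (gt_mem_nhds (show u w < m' by simp only [m']; linarith))] with w' hw'
      rw [Real.smoothTransition.zero_of_nonpos (x := u w' - m') (by linarith), mul_zero]
    · have hwf : w ∈ frontier V :=
        ⟨closure_mono inter_subset_left hw.1, by rwa [hV, interior_interior]⟩
      rcases lt_or_ge (v w) m with hvm | hvm
      · left
        filter_upwards [(hv w hwC).1.continuousAt.eventually (gt_mem_nhds hvm)] with w' hw'
        rw [Real.smoothTransition.zero_of_nonpos (x := v w' - m) (by linarith), zero_mul]
      · right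
        intro hwz
        have h1 := hd w hwf
        have h2 := hwz F (isAscending_self hF)
        have h3 : L * F w ≤ L * F z := mul_le_mul_of_nonneg_left h2 hL.le
        have h4 : L * F z < L * F x₀ + d / 2 := hzF
        simp only [v] at hvm
        linarith

/-- The order is antisymmetric; more precisely `F` is strictly increasing. -/
theorem Below.eq_of_eq (hY : HasFaceCharts n Y) (hYc : IsClosed Y)
    (hF : ∀ x, AdaptedAt g Y F x) (hF0 : ∀ x, 0 ≤ F x) (hfin : (criticalSet n F).Finite)
    (h : Below g Y F x y) (hxy : F x = F y) : x = y := by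
  by_contra hne
  have hFF := isAscending_self hF
  obtain ⟨w, -, -, hwy, hwc, hxw, hwy'⟩ := h.exists_between hY hYc hF hF0 hfin hne univ_mem
  have hw : F w = F y := le_antisymm (hwy' F hFF) (hxy ▸ hxw F hFF)
  obtain ⟨D, L, hL, hDw, hD⟩ := exists_gradProd_le_mul hY hYc hF hwc
  obtain ⟨N, hN, hNle⟩ := exists_forall_le_of_below (u := fun z => L * F z - D z) hY hYc hF hF0 hwc
    (by
      filter_upwards [hD] with z hz
      refine ⟨((hF z).const_mul hY L).sub hY hz.1, ?_⟩
      rw [gradProd_sub ((hF z).const_mul hY L).1 hz.1.1, gradProd_const_mul L (hF z).1]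
      linarith [hz.2.2.2])
  obtain ⟨z, hz, hzw, -, -, hwz, hzy⟩ := hwy'.exists_between hY hYc hF hF0 hfin hwy
    (inter_mem hN hD)
  have h1 := hNle w (mem_of_mem_nhds hN) z hz.1 hwz
  have h2 : F z = F w := le_antisymm (hw ▸ hzy F hFF) (hwz F hFF)
  rw [h2, hDw] at h1
  exact hzw (hz.2.2.2.1 (le_antisymm (by linarith) hz.2.2.1))

end Order

/-! ### Maximal chains of the preorder -/

section Chain

variable {n : ℕ} {Ω : Type*} [TopologicalSpace Ω] [ChartedSpace (EuclideanQuadrant (n + 1)) Ω]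
  [IsManifold (cornerModel n) ∞ Ω] {g : Metric n Ω} {Y : Set Ω} {F k : Ω → ℝ} {p q : Ω}
  [T2Space Ω] [CompactSpace Ω]

/-- If `p` is below `q`, then a maximal chain from `p` to `q` is a continuous curve, parametrized
by the values of `F`. -/
theorem Below.exists_curve (hY : HasFaceCharts n Y) (hYc : IsClosed Y)
    (hF : ∀ x, AdaptedAt g Y F x) (hF0 : ∀ x, 0 ≤ F x) (hfin : (criticalSet n F).Finite)
    (hpq : Below g Y F p q) :
    ∃ γ : ℝ → Ω, Continuous γ ∧ γ (F p) = p ∧ γ (F q) = q ∧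
      (∀ s ∈ Icc (F p) (F q), F (γ s) = s) ∧
      ∀ s ∈ Icc (F p) (F q), ∀ t ∈ Icc (F p) (F q), s ≤ t → Below g Y F (γ s) (γ t) := by
  have hFF := isAscending_self hF
  have hFc : Continuous F := hFF.continuous
  obtain ⟨S, hS, hpqS⟩ := IsChain.exists_maxChain (r := Below g Y F) (c := {p, q}) (by
    rintro x (rfl | rfl) y (rfl | rfl) hne
    exacts [absurd rfl hne, Or.inl hpq, Or.inr hpq, absurd rfl hne])
  have hcomp : ∀ x ∈ S, ∀ y ∈ S, Below g Y F x y ∨ Below g Y F y x := by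
    intro x hx y hy
    by_cases hxy : x = y
    · exact Or.inl (hxy ▸ Below.refl x)
    · exact hS.1 hx hy hxy
  have hmem : ∀ z, (∀ x ∈ S, Below g Y F x z ∨ Below g Y F z x) → z ∈ S := by
    intro z hz
    have h1 : IsChain (Below g Y F) (insert z S) :=
      hS.1.insert fun b hb _ => (hz b hb).symm
    rw [hS.2 h1 (subset_insert z S)]
    exact mem_insert z S
  have hScl : IsClosed S := by
    have h1 : IsClosed {w : Ω × Ω | Below g Y F w.1 w.2 ∨ Below g Y F w.2 w.1} :=
      isClosed_below.union (isClosed_below.preimage continuous_swap)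
    have h2 : closure S ×ˢ closure S ⊆ {w : Ω × Ω | Below g Y F w.1 w.2 ∨ Below g Y F w.2 w.1} := by
      rw [← closure_prod_eq]
      exact closure_minimal (fun w hw => hcomp _ hw.1 _ hw.2) h1
    refine isClosed_of_closure_subset fun z hz => hmem z fun x hx => ?_
    exact h2 (mk_mem_prod (subset_closure hx) hz)
  -- the part of the chain between `p` and `q`
  set C : Set Ω := S ∩ {z | Below g Y F p z ∧ Below g Y F z q} with hC
  have hpC : p ∈ C := ⟨hpqS (by simp), Below.refl p, hpq⟩
  have hqC : q ∈ C := ⟨hpqS (by simp), hpq, Below.refl q⟩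
  have hCcl : IsClosed C := hScl.inter
    ((isClosed_below.preimage (by fun_prop : Continuous fun z : Ω => (p, z))).inter
      (isClosed_below.preimage (by fun_prop : Continuous fun z : Ω => (z, q))))
  have hinj : ∀ x ∈ C, ∀ y ∈ C, F x = F y → x = y := by
    intro x hx y hy hxy
    rcases hcomp x hx.1 y hy.1 with h | h
    · exact h.eq_of_eq hY hYc hF hF0 hfin hxy
    · exact (h.eq_of_eq hY hYc hF hF0 hfin hxy.symm).symm
  have hle : ∀ x ∈ C, ∀ y ∈ C, F x ≤ F y → Below g Y F x y := by
    intro x hx y hy hxy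
    rcases hcomp x hx.1 y hy.1 with h | h
    · exact h
    · rw [hinj x hx y hy (le_antisymm hxy (h F hFF))]
      exact Below.refl y
  have hmemC : ∀ z, Below g Y F p z → Below g Y F z q →
      (∀ x ∈ C, Below g Y F x z ∨ Below g Y F z x) → z ∈ C := by
    intro z hpz hzq hz
    refine ⟨hmem z fun x hx => ?_, hpz, hzq⟩
    rcases hcomp x hx p hpC.1 with h | h
    · exact Or.inl (h.trans hpz)
    rcases hcomp x hx q hqC.1 with h' | h'
    · exact hz x ⟨hx, h, h'⟩
    · exact Or.inr (hzq.trans h')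
  -- a gap in the chain could be filled by `Below.exists_between`, against maximality
  have hsurj : ∀ s ∈ Icc (F p) (F q), ∃ x ∈ C, F x = s := by
    intro s hs
    by_contra! hno
    obtain ⟨x₁, hx₁, hmax⟩ := (hCcl.isCompact.inter_right
      (isClosed_le hFc (continuous_const (y := s)))).exists_isMaxOn ⟨p, hpC, hs.1⟩ hFc.continuousOn
    obtain ⟨x₂, hx₂, hmin⟩ := (hCcl.isCompact.inter_right
      (isClosed_le (continuous_const (y := s)) hFc)).exists_isMinOn ⟨q, hqC, hs.2⟩ hFc.continuousOn
    have h1 : F x₁ < s := lt_of_le_of_ne hx₁.2 (hno x₁ hx₁.1)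
    have h2 : s < F x₂ := lt_of_le_of_ne hx₂.2 (hno x₂ hx₂.1).symm
    have h12 := hle x₁ hx₁.1 x₂ hx₂.1 (h1.trans h2).le
    obtain ⟨z, -, hz1, hz2, -, h1z, hz2'⟩ := h12.exists_between hY hYc hF hF0 hfin
      (fun h => by rw [h] at h1; exact lt_asymm h1 h2) univ_mem
    have hzC : z ∈ C := by
      refine hmemC z (hx₁.1.2.1.trans h1z) (hz2'.trans hx₂.1.2.2) fun c hc => ?_
      rcases le_total (F c) s with h | h
      · exact Or.inl ((hle c hc x₁ hx₁.1 (hmax ⟨hc, h⟩)).trans h1z)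
      · exact Or.inr (hz2'.trans (hle x₂ hx₂.1 c hc (hmin ⟨hc, h⟩)))
    rcases le_total (F z) s with h | h
    · exact hz1 (hinj z hzC x₁ hx₁.1 (le_antisymm (hmax ⟨hzC, h⟩) (h1z F hFF)))
    · exact hz2 (hinj z hzC x₂ hx₂.1 (le_antisymm (hz2' F hFF) (hmin ⟨hzC, h⟩)))
  let Φ : C → Icc (F p) (F q) := fun x => ⟨F x, x.2.2.1 F hFF, x.2.2.2 F hFF⟩
  have hΦ : Function.Bijective Φ := by
    refine ⟨fun x y hxy => Subtype.ext (hinj x x.2 y y.2 (congrArg Subtype.val hxy)), fun s => ?_⟩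
    obtain ⟨x, hx, hxs⟩ := hsurj s s.2
    exact ⟨⟨x, hx⟩, Subtype.ext hxs⟩
  have : CompactSpace C := isCompact_iff_compactSpace.1 hCcl.isCompact
  let e : C ≃ₜ Icc (F p) (F q) := Continuous.homeoOfEquivCompactToT2
    (f := Equiv.ofBijective Φ hΦ) ((hFc.comp continuous_subtype_val).subtype_mk _)
  have hle' : F p ≤ F q := hpq F hFF
  have hFe : ∀ s : Icc (F p) (F q), F (e.symm s) = s := fun s =>
    congrArg Subtype.val (e.apply_symm_apply s)
  have hγ : ∀ s ∈ Icc (F p) (F q), F (e.symm (projIcc (F p) (F q) hle' s)) = s := by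
    intro s hs
    rw [hFe, projIcc_of_mem hle' hs]
  refine ⟨fun s => e.symm (projIcc (F p) (F q) hle' s), ?_, ?_, ?_, hγ, ?_⟩
  · exact continuous_subtype_val.comp (e.symm.continuous.comp continuous_projIcc)
  · exact hinj _ (Subtype.mem _) p hpC (hγ _ (left_mem_Icc.2 hle'))
  · exact hinj _ (Subtype.mem _) q hqC (hγ _ (right_mem_Icc.2 hle'))
  · intro s hs t ht hst
    refine hle _ (Subtype.mem _) _ (Subtype.mem _) ?_
    rwa [hγ s hs, hγ t ht]

/-- A curve which is increasing for the order and parametrized by the values of `F` follows the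
vector field `∇F / |∇F|²`, when tested on adapted functions. -/
theorem hasDerivAt_comp_of_adaptedAt (hY : HasFaceCharts n Y) (hYc : IsClosed Y)
    (hF : ∀ x, AdaptedAt g Y F x) (hF0 : ∀ x, 0 ≤ F x) {γ : ℝ → Ω} {a b s : ℝ}
    (hγ : Continuous γ) (hγF : ∀ s ∈ Ioo a b, F (γ s) = s)
    (hγle : ∀ s ∈ Ioo a b, ∀ t ∈ Ioo a b, s ≤ t → Below g Y F (γ s) (γ t)) (hs : s ∈ Ioo a b)
    (hcrit : γ s ∉ criticalSet n F) (hk : ∀ᶠ z in 𝓝 (γ s), AdaptedAt g Y k z) :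
    HasDerivAt (fun t => k (γ t)) (gradProd g F k (γ s) / gradProd g F F (γ s)) s := by
  set c := gradProd g F k (γ s) / gradProd g F F (γ s) with hc
  have hpos : 0 < gradProd g F F (γ s) := gradProd_self_pos hcrit
  rw [hasDerivAt_iff_isLittleO, Asymptotics.isLittleO_iff]
  intro ε hε
  have hkc : ContinuousAt (gradProd g F k) (γ s) :=
    ContMDiffAt.continuousAt ((hF _).1.gradProd hk.self_of_nhds.1)
  have hFFc : Continuous (gradProd g F F) := continuous_gradProd hF hF
  have hceq : c * gradProd g F F (γ s) = gradProd g F k (γ s) := div_mul_cancel₀ _ hpos.ne'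
  have h1 : ∀ᶠ z in 𝓝 (γ s), gradProd g F k z < (c + ε) * gradProd g F F z :=
    hkc.eventually_lt (hFFc.continuousAt.const_mul _)
      (show gradProd g F k (γ s) < (c + ε) * gradProd g F F (γ s) by nlinarith)
  have h2 : ∀ᶠ z in 𝓝 (γ s), (c - ε) * gradProd g F F z < gradProd g F k z :=
    (hFFc.continuousAt.const_mul _).eventually_lt hkc
      (show (c - ε) * gradProd g F F (γ s) < gradProd g F k (γ s) by nlinarith)
  obtain ⟨N₁, hN₁, hle₁⟩ := exists_forall_le_of_below (u := fun z => (c + ε) * F z - k z)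
    hY hYc hF hF0 hcrit (by
      filter_upwards [hk, h1] with z hz hz1
      refine ⟨((hF z).const_mul hY _).sub hY hz, ?_⟩
      rw [gradProd_sub ((hF z).const_mul hY _).1 hz.1, gradProd_const_mul _ (hF z).1]
      linarith)
  obtain ⟨N₂, hN₂, hle₂⟩ := exists_forall_le_of_below (u := fun z => k z - (c - ε) * F z)
    hY hYc hF hF0 hcrit (by
      filter_upwards [hk, h2] with z hz hz1
      refine ⟨hz.sub hY ((hF z).const_mul hY _), ?_⟩
      rw [gradProd_sub hz.1 ((hF z).const_mul hY _).1, gradProd_const_mul _ (hF z).1]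
      linarith)
  filter_upwards [hγ.continuousAt.eventually hN₁, hγ.continuousAt.eventually hN₂,
    isOpen_Ioo.mem_nhds hs] with t ht₁ ht₂ ht
  have hsF := hγF s hs
  have htF := hγF t ht
  simp only [smul_eq_mul, Real.norm_eq_abs]
  rcases le_total s t with hst | hst
  · have h3 := hle₁ _ (mem_of_mem_nhds hN₁) _ ht₁ (hγle s hs t ht hst)
    have h4 := hle₂ _ (mem_of_mem_nhds hN₂) _ ht₂ (hγle s hs t ht hst)
    rw [hsF, htF] at h3 h4
    rw [abs_of_nonneg (sub_nonneg.2 hst), abs_le]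
    constructor <;> linarith
  · have h3 := hle₁ _ ht₁ _ (mem_of_mem_nhds hN₁) (hγle t ht s hs hst)
    have h4 := hle₂ _ ht₂ _ (mem_of_mem_nhds hN₂) (hγle t ht s hs hst)
    rw [hsF, htF] at h3 h4
    rw [abs_of_nonpos (sub_nonpos.2 hst), abs_le]
    constructor <;> linarith

/-- A curve which is increasing for the order and meets `Y = {ρ = 0}` stays in `Y`: the functions
`ρ² exp (c F)` and `-ρ² exp (-c F)` ascend near `Y` when `c` is large. -/
theorem coord_eq_zero_of_below (hY : HasFaceCharts n Y) (hYc : IsClosed Y)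
    (hF : ∀ x, AdaptedAt g Y F x) (hF0 : ∀ x, 0 ≤ F x) {x₀ : Ω} (hx₀ : x₀ ∈ Y)
    (hcrit : x₀ ∉ criticalSet n F) {φ : OpenPartialHomeomorph Ω (EuclideanQuadrant (n + 1))}
    {a : Fin (n + 1)} (hφ : IsSmoothChartAt φ x₀) (ha : IsFaceIn Y φ a) :
    ∀ᶠ z in 𝓝 x₀, Below g Y F x₀ z ∨ Below g Y F z x₀ → (φ z).1 a = 0 := by
  let ρ : Ω → ℝ := fun z => (φ z).1 a
  have hpos : 0 < gradProd g F F x₀ := gradProd_self_pos hcrit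
  have hs : ∀ᶠ z in 𝓝 x₀, IsSmoothChartAt φ z := by
    filter_upwards [φ.open_source.mem_nhds hφ.2] with x hx using ⟨hφ.1, hx⟩
  obtain ⟨K, hK0, hK⟩ := hφ.exists_abs_le_mul_coord (u := gradProd g F ρ) hx₀ ha
    ((hF x₀).1.gradProd (hφ.smoothAt_coord a))
    (hs.mono fun z hz hzY => (hF z).gradProd_eq_zero hzY hz ha)
  have hm : ∀ᶠ z in 𝓝 x₀, gradProd g F F x₀ / 2 < gradProd g F F z :=
    (continuous_gradProd hF hF).continuousAt.eventually (lt_mem_nhds (by linarith))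
  set C : ℝ := 4 * K / gradProd g F F x₀ with hC
  have hC0 : 0 ≤ C := by positivity
  have hbd : ∀ᶠ z in 𝓝 x₀, |2 * ρ z * gradProd g F ρ z| ≤ C * (ρ z ^ 2 * gradProd g F F z) := by
    filter_upwards [hK, hm] with z hz hz2
    have hρ : 0 ≤ ρ z := (φ z).2 a
    have h1 : |2 * ρ z * gradProd g F ρ z| ≤ 2 * ρ z * (K * ρ z) := by
      rw [abs_mul, abs_of_nonneg (by positivity : 0 ≤ 2 * ρ z)]
      exact mul_le_mul_of_nonneg_left hz (by positivity)
    have h2 : C * (ρ z ^ 2 * (gradProd g F F x₀ / 2)) = 2 * ρ z * (K * ρ z) := by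
      rw [hC]; field_simp; ring
    rw [← h2] at h1
    exact h1.trans (by gcongr)
  have hsq : ∀ᶠ z in 𝓝 x₀, ∀ c : ℝ, AdaptedAt g Y (fun z => Real.exp (c * F z) * ρ z ^ 2) z ∧
      gradProd g F (fun z => Real.exp (c * F z) * ρ z ^ 2) z =
        Real.exp (c * F z) * (2 * ρ z * gradProd g F ρ z + c * (ρ z ^ 2 * gradProd g F F z)) := by
    filter_upwards [hs] with z hz c
    have h1 : AdaptedAt g Y (fun z => ρ z ^ 2) z := adaptedAt_coord_sq hz ha
    have hexp : ContDiff ℝ ∞ fun t => Real.exp (c * t) := by fun_prop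
    have h2 : AdaptedAt g Y (fun z => Real.exp (c * F z)) z := (hF z).comp hY hexp
    have h3 : deriv (fun t => Real.exp (c * t)) (F z) = c * Real.exp (c * F z) := by
      have := ((hasDerivAt_id (F z)).const_mul c).exp.deriv
      simp only [id, mul_one] at this
      rw [this, mul_comm]
    refine ⟨h2.mul hY h1, ?_⟩
    rw [gradProd_mul h2.1 h1.1, gradProd_comp (θ := fun t => Real.exp (c * t))
      (hexp.differentiable (by simp)) (hF z).1, h3,
      gradProd_comp (θ := fun t => t ^ 2) (by fun_prop) (hz.smoothAt_coord a)]
    simp only [differentiableAt_fun_id, deriv_fun_pow, deriv_id'']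
    push_cast
    ring
  obtain ⟨N₁, hN₁, hle₁⟩ := exists_forall_le_of_below
    (u := fun z => Real.exp (C * F z) * ρ z ^ 2) hY hYc hF hF0 hcrit (by
      filter_upwards [hsq, hbd] with z hz hz1
      refine ⟨(hz C).1, ?_⟩
      rw [(hz C).2]
      exact mul_nonneg (Real.exp_pos _).le (by linarith [neg_abs_le (2 * ρ z * gradProd g F ρ z)]))
  obtain ⟨N₂, hN₂, hle₂⟩ := exists_forall_le_of_below
    (u := fun z => (-1) * (Real.exp (-C * F z) * ρ z ^ 2)) hY hYc hF hF0 hcrit (by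
      filter_upwards [hsq, hbd] with z hz hz1
      refine ⟨(hz (-C)).1.const_mul hY _, ?_⟩
      rw [gradProd_const_mul _ (hz (-C)).1.1, (hz (-C)).2]
      have := mul_nonneg (Real.exp_pos (-C * F z)).le
        (show 0 ≤ C * (ρ z ^ 2 * gradProd g F F z) - 2 * ρ z * gradProd g F ρ z by
          linarith [le_abs_self (2 * ρ z * gradProd g F ρ z)])
      linarith)
  have hρ₀ : ρ x₀ = 0 := (ha x₀ hφ.2).1 hx₀
  filter_upwards [hN₁, hN₂] with z hz₁ hz₂ hz
  have h0 : ∀ c : ℝ, Real.exp c * ρ z ^ 2 ≤ 0 → ρ z = 0 := by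
    intro c h
    have h1 : Real.exp c * ρ z ^ 2 = 0 := le_antisymm h (by positivity)
    simpa [Real.exp_ne_zero] using h1
  rcases hz with hz | hz
  · have h1 := hle₂ _ (mem_of_mem_nhds hN₂) _ hz₂ hz
    simp only [hρ₀] at h1
    exact h0 (-C * F z) (by linarith)
  · have h1 := hle₁ _ hz₁ _ (mem_of_mem_nhds hN₁) hz
    simp only [hρ₀] at h1
    exact h0 (C * F z) (by linarith)

/-- A curve which is increasing for the order and parametrized by the values of `F` follows the
vector field `∇F / |∇F|²`. -/
theorem hasDerivAt_comp_of_below (hY : HasFaceCharts n Y) (hYc : IsClosed Y)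
    (hF : ∀ x, AdaptedAt g Y F x) (hF0 : ∀ x, 0 ≤ F x) {γ : ℝ → Ω} {a b s : ℝ}
    (hγ : Continuous γ) (hγF : ∀ s ∈ Ioo a b, F (γ s) = s)
    (hγle : ∀ s ∈ Ioo a b, ∀ t ∈ Ioo a b, s ≤ t → Below g Y F (γ s) (γ t)) (hs : s ∈ Ioo a b)
    (hcrit : γ s ∉ criticalSet n F) (hk : ∀ᶠ z in 𝓝 (γ s), SmoothAt n k z) :
    HasDerivAt (fun t => k (γ t)) (gradProd g F k (γ s) / gradProd g F F (γ s)) s := by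
  by_cases hsY : γ s ∈ Y
  · obtain ⟨φ, i, hφ, hi⟩ := hY _ hsY
    obtain ⟨w, hw, hkw⟩ := exists_adaptedAt_sub_mul (g := g) hφ hi hk
    have h1 := hasDerivAt_comp_of_adaptedAt hY hYc hF hF0 hγ hγF hγle hs hcrit hkw
    have h2 : gradProd g F (fun x => k x - (φ x).1 i * w x) (γ s) = gradProd g F k (γ s) := by
      have hw0 := hw.self_of_nhds
      have hρ := hφ.smoothAt_coord i
      rw [gradProd_sub hk.self_of_nhds (show SmoothAt n (fun x => (φ x).1 i * w x) (γ s) from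
        ContMDiffAt.mul hρ hw0), gradProd_mul hρ hw0,
        (hF _).gradProd_eq_zero hsY hφ hi, (hi _ hφ.2).1 hsY]
      ring
    rw [h2] at h1
    refine h1.congr_of_eventuallyEq ?_
    filter_upwards [hγ.continuousAt.eventually
      (coord_eq_zero_of_below hY hYc hF hF0 hsY hcrit hφ hi), isOpen_Ioo.mem_nhds hs] with t ht hts
    have h3 : (φ (γ t)).1 i = 0 := ht ((le_total s t).imp (hγle s hs t hts) (hγle t hts s hs))
    rw [h3, zero_mul, sub_zero]
  · refine hasDerivAt_comp_of_adaptedAt hY hYc hF hF0 hγ hγF hγle hs hcrit ?_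
    filter_upwards [hk, hYc.isOpen_compl.mem_nhds hsY] with z hz hzY
    exact adaptedAt_of_notMem hzY hz

end Chain

/-! ### Trajectories between critical points -/

section Reparametrization

/-- The time `T = ∫ 1 / w` needed to reach `b` along `s' = w (s)` is infinite, if there is a
positive function `r` which tends to zero at `b` and satisfies `|r'| w ≤ C r`: the function `log r + C T` is
increasing, and `log r` tends to `-∞`. -/
theorem tendsto_atTop_of_abs_deriv_le {a b C : ℝ} {w T r r' : ℝ → ℝ} (hab : a < b)
    (hw : ∀ s ∈ Ioo a b, 0 < w s) (hT : ∀ s ∈ Ioo a b, HasDerivAt T (w s)⁻¹ s) (hC : 0 < C)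
    (hr : ∀ᶠ s in 𝓝[<] b, 0 < r s ∧ HasDerivAt r (r' s) s ∧ |r' s| * w s ≤ C * r s)
    (hr0 : Tendsto r (𝓝[<] b) (𝓝 0)) : Tendsto T (𝓝[<] b) atTop := by
  obtain ⟨s₁, hs₁, h⟩ := mem_nhdsLT_iff_exists_Ico_subset.1
    (inter_mem hr (Ioo_mem_nhdsLT hab))
  have hG : ∀ s ∈ Ico s₁ b, HasDerivAt (fun s => Real.log (r s) + C * T s)
      (r' s / r s + C * (w s)⁻¹) s := fun s hs =>
    ((h hs).1.2.1.log (h hs).1.1.ne').add ((hT s (h hs).2).const_mul C)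
  have hmono : MonotoneOn (fun s => Real.log (r s) + C * T s) (Ico s₁ b) := by
    refine monotoneOn_of_deriv_nonneg (convex_Ico _ _)
      (fun s hs => (hG s hs).continuousAt.continuousWithinAt) ?_ ?_
    · exact fun s hs => (hG s (interior_subset hs)).differentiableAt.differentiableWithinAt
    · intro s hs
      have hs' := interior_subset hs
      rw [(hG s hs').deriv]
      obtain ⟨⟨hrs, -, hle⟩, hsab⟩ := h hs'
      have hws := hw s hsab
      have h1 : r' s / r s + C * (w s)⁻¹ = (r' s * w s + C * r s) / (r s * w s) := by
        field_simp
      rw [h1]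
      refine div_nonneg ?_ (mul_pos hrs hws).le
      have h2 : -(|r' s| * w s) ≤ r' s * w s := by
        rw [← neg_mul]
        exact mul_le_mul_of_nonneg_right (neg_abs_le _) hws.le
      linarith
  have hs₁' : s₁ ∈ Ico s₁ b := ⟨le_rfl, hs₁⟩
  have hlog : Tendsto (fun s => Real.log (r s)) (𝓝[<] b) atBot :=
    Real.tendsto_log_nhdsGT_zero.comp
      (tendsto_nhdsWithin_iff.2 ⟨hr0, hr.mono fun s hs => hs.1⟩)
  -- `C T ≥ (log r + C T) (s₁) - log r` on `[s₁, b)`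
  refine tendsto_atTop_mono' (𝓝[<] b)
    (f₁ := fun s => C⁻¹ * ((Real.log (r s₁) + C * T s₁) + - Real.log (r s))) ?_ ?_
  · filter_upwards [Ico_mem_nhdsLT hs₁] with s hs
    rw [inv_mul_le_iff₀ hC]
    have := hmono hs₁' hs hs.1
    simp only at this
    linarith
  · exact (tendsto_atTop_add_const_left _ _ (tendsto_neg_atBot_atTop.comp hlog)).const_mul_atTop
      (inv_pos.2 hC)

/-- The autonomous equation `σ' = w (σ)` with `w > 0` on a bounded interval has a solution defined
for all times, if near each end there is a positive function `r` which tends to zero at this end and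
satisfies `|r'| w ≤ C r`, so that `r` decreases at most exponentially along the solution. -/
theorem exists_hasDerivAt_comp {a b C : ℝ} {w r₀ r₀' r₁ r₁' : ℝ → ℝ} (hab : a < b)
    (hw : ∀ s ∈ Ioo a b, 0 < w s) (hwc : ContinuousOn w (Ioo a b)) (hC : 0 < C)
    (hr₀ : ∀ᶠ s in 𝓝[>] a, 0 < r₀ s ∧ HasDerivAt r₀ (r₀' s) s ∧ |r₀' s| * w s ≤ C * r₀ s)
    (hr₀0 : Tendsto r₀ (𝓝[>] a) (𝓝 0))
    (hr₁ : ∀ᶠ s in 𝓝[<] b, 0 < r₁ s ∧ HasDerivAt r₁ (r₁' s) s ∧ |r₁' s| * w s ≤ C * r₁ s)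
    (hr₁0 : Tendsto r₁ (𝓝[<] b) (𝓝 0)) :
    ∃ σ : ℝ → ℝ, (∀ t, σ t ∈ Ioo a b ∧ HasDerivAt σ (w (σ t)) t) ∧
      Tendsto σ atTop (𝓝 b) ∧ Tendsto σ atBot (𝓝 a) := by
  -- the time as a function of the position
  let T : ℝ → ℝ := fun s => ∫ x in (a + b) / 2..s, (w x)⁻¹
  have hmid : (a + b) / 2 ∈ Ioo a b := ⟨by linarith, by linarith⟩
  have hic : ContinuousOn (fun x => (w x)⁻¹) (Ioo a b) :=
    hwc.inv₀ fun s hs => (hw s hs).ne'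
  have hT : ∀ s ∈ Ioo a b, HasDerivAt T (w s)⁻¹ s := by
    intro s hs
    refine intervalIntegral.integral_hasDerivAt_right
      ((hic.mono (ordConnected_Ioo.uIcc_subset hmid hs)).intervalIntegrable)
      (hic.stronglyMeasurableAtFilter isOpen_Ioo s hs) (hic.continuousAt (isOpen_Ioo.mem_nhds hs))
  have hTb : Tendsto T (𝓝[<] b) atTop := tendsto_atTop_of_abs_deriv_le hab hw hT hC hr₁ hr₁0
  have hTa : Tendsto T (𝓝[>] a) atBot := by
    have hneg : Tendsto (fun s : ℝ => -s) (𝓝[<] (-a)) (𝓝[>] a) := by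
      simpa using tendsto_neg_nhdsLT (a := -a)
    have h1 : Tendsto (fun s => - T (-s)) (𝓝[<] (-a)) atTop := by
      refine tendsto_atTop_of_abs_deriv_le (w := fun s => w (-s)) (r := fun s => r₀ (-s))
        (r' := fun s => - r₀' (-s)) (neg_lt_neg hab)
        (fun s hs => hw _ ⟨lt_neg_of_lt_neg hs.2, neg_lt.1 hs.1⟩) (fun s hs => ?_) hC ?_
        (hr₀0.comp hneg)
      · have := ((hT (-s) ⟨lt_neg_of_lt_neg hs.2, neg_lt.1 hs.1⟩).comp s (hasDerivAt_neg s)).neg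
        rw [mul_neg_one, neg_neg] at this
        exact this
      · filter_upwards [hneg.eventually hr₀] with s hs
        refine ⟨hs.1, ?_, by simpa using hs.2.2⟩
        have := hs.2.1.comp s (hasDerivAt_neg s)
        rw [mul_neg_one] at this
        exact this
    have h2 : Tendsto (fun s : ℝ => -s) (𝓝[>] a) (𝓝[<] (-a)) := tendsto_neg_nhdsGT
    have h3 := tendsto_neg_atTop_atBot.comp (h1.comp h2)
    simpa [Function.comp_def] using h3
  have hTmono : StrictMono fun s : Ioo a b => T s := by
    have h1 : StrictMonoOn T (Ioo a b) := by
      refine strictMonoOn_of_deriv_pos (convex_Ioo _ _)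
        (fun s hs => (hT s hs).continuousAt.continuousWithinAt) fun s hs => ?_
      rw [interior_Ioo] at hs
      rw [(hT s hs).deriv]
      exact inv_pos.2 (hw s hs)
    exact fun s t hst => h1 s.2 t.2 hst
  have hTsurj : Function.Surjective fun s : Ioo a b => T s := by
    intro t
    obtain ⟨s, hs, hst⟩ := (Eventually.and (Ioo_mem_nhdsGT hab)
      (hTa.eventually (eventually_le_atBot t))).exists
    obtain ⟨s', hs', hst'⟩ := (Eventually.and (Ioo_mem_nhdsLT hab)
      (hTb.eventually (eventually_ge_atTop t))).exists
    obtain ⟨z, hz, hzt⟩ := isPreconnected_Ioo.intermediate_value hs hs'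
      (fun s hs => (hT s hs).continuousAt.continuousWithinAt) ⟨hst, hst'⟩
    exact ⟨⟨z, hz⟩, hzt⟩
  let e : Ioo a b ≃o ℝ := hTmono.orderIsoOfSurjective _ hTsurj
  have he : ∀ t, T (e.symm t) = t := fun t => e.apply_symm_apply t
  refine ⟨fun t => e.symm t, fun t => ⟨(e.symm t).2, ?_⟩, ?_, ?_⟩
  · have h1 := HasDerivAt.of_local_left_inverse (f := T) (g := fun t => (e.symm t : ℝ)) (a := t)
      (continuous_subtype_val.comp e.symm.continuous).continuousAt
      (hT _ (e.symm t).2) (inv_pos.2 (hw _ (e.symm t).2)).ne' (Eventually.of_forall he)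
    rwa [inv_inv] at h1
  · refine tendsto_order.2 ⟨fun c hc => ?_, fun c hc =>
      Eventually.of_forall fun t => (e.symm t).2.2.trans hc⟩
    have hm : max c ((a + b) / 2) ∈ Ioo a b := ⟨lt_max_of_lt_right hmid.1, max_lt hc hmid.2⟩
    filter_upwards [eventually_gt_atTop (e ⟨_, hm⟩)] with t ht
    have h1 : (⟨_, hm⟩ : Ioo a b) < e.symm t := e.lt_symm_apply.2 ht
    exact (le_max_left _ _).trans_lt h1
  · refine tendsto_order.2 ⟨fun c hc =>
      Eventually.of_forall fun t => hc.trans (e.symm t).2.1, fun c hc => ?_⟩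
    have hm : min c ((a + b) / 2) ∈ Ioo a b := ⟨lt_min hc hmid.1, min_lt_of_right_lt hmid.2⟩
    filter_upwards [eventually_lt_atBot (e ⟨_, hm⟩)] with t ht
    have h1 : e.symm t < (⟨_, hm⟩ : Ioo a b) := e.symm_apply_lt.2 ht
    exact lt_of_lt_of_le h1 (min_le_left _ _)

end Reparametrization

section Trajectory

variable {n : ℕ} {Ω : Type*} [TopologicalSpace Ω] [ChartedSpace (EuclideanQuadrant (n + 1)) Ω]
  [IsManifold (cornerModel n) ∞ Ω] {g : Metric n Ω} {Y : Set Ω} {F : Ω → ℝ} {p q : Ω}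

/-- The square `R` of the distance to a critical point in a chart changes at most exponentially
along the gradient flow. -/
theorem exists_abs_gradProd_le (hF : ContMDiff (cornerModel n) 𝓘(ℝ, ℝ) ∞ F)
    (hp : p ∈ criticalSet n F) :
    ∃ (R : Ω → ℝ) (C : ℝ), 0 < C ∧ R p = 0 ∧
      ∀ᶠ x in 𝓝 p, SmoothAt n R x ∧ (x ≠ p → 0 < R x) ∧ |gradProd g F R x| ≤ C * R x := by
  let φ := chartAt (EuclideanQuadrant (n + 1)) p
  have hφ : IsSmoothChartAt φ p :=
    ⟨IsManifold.chart_mem_maximalAtlas p, mem_chart_source _ p⟩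
  let k : Fin (n + 1) → Ω → ℝ := fun i x => (φ x).1 i
  have h1 : ∀ i, ∃ K : ℝ, 0 ≤ K ∧
      ∀ᶠ x in 𝓝 p, |gradProd g F (k i) x| ≤ K * ‖(φ x).1 - (φ p).1‖ := fun i =>
    hφ.exists_abs_le_mul_norm (SmoothAt.gradProd (hF p) (hφ.smoothAt_coord i))
      (by rw [gradProd_comm]; exact gradProd_of_mem_criticalSet hp)
  choose K hK0 hK using h1
  have hR : ∀ x, ∑ i, (k i x - k i p) ^ 2 = ‖(φ x).1 - (φ p).1‖ ^ 2 := fun x => by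
    rw [EuclideanSpace.real_norm_sq_eq]
    rfl
  refine ⟨fun x => ∑ i, (k i x - k i p) ^ 2, ∑ i, 2 * K i + 1, ?_, by simp, ?_⟩
  · exact add_pos_of_nonneg_of_pos (Finset.sum_nonneg fun i _ => by linarith [hK0 i]) one_pos
  filter_upwards [φ.open_source.mem_nhds hφ.2, eventually_all.2 hK] with x hx hxK
  have hφx : IsSmoothChartAt φ x := ⟨hφ.1, hx⟩
  have hki : ∀ i, SmoothAt n (fun x => k i x - k i p) x := fun i =>
    ContMDiffAt.sub (hφx.smoothAt_coord i) contMDiffAt_const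
  have hsq : ∀ i, SmoothAt n (fun x => (k i x - k i p) ^ 2) x := fun i =>
    (hki i).comp_real (θ := fun t => t ^ 2) (by fun_prop)
  refine ⟨contMDiffAt_finsetSum fun i _ => hsq i, fun hne => ?_, ?_⟩
  · rw [hR]
    have : (φ x).1 - (φ p).1 ≠ 0 := fun h0 =>
      hne (φ.injOn hx hφ.2 (Subtype.ext (sub_eq_zero.1 h0)))
    positivity
  · rw [gradProd_sum _ fun i _ => hsq i, hR, add_mul, Finset.sum_mul]
    refine (Finset.abs_sum_le_sum_abs _ _).trans ?_
    refine le_add_of_le_of_nonneg (Finset.sum_le_sum fun i _ => ?_) (by positivity)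
    rw [gradProd_comp (θ := fun t => t ^ 2) (by fun_prop) (hki i),
      gradProd_sub_const _ (hφx.smoothAt_coord i)]
    simp only [differentiableAt_fun_id, deriv_fun_pow, deriv_id'']
    have h2 : |k i x - k i p| ≤ ‖(φ x).1 - (φ p).1‖ :=
      PiLp.norm_apply_le ((φ x).1 - (φ p).1) i
    have h3 : |2 * (k i x - k i p) * gradProd g F (k i) x| ≤
        2 * ‖(φ x).1 - (φ p).1‖ * (K i * ‖(φ x).1 - (φ p).1‖) := by
      rw [abs_mul, abs_mul, abs_two]
      have := hxK i
      gcongr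
    calc _ = |2 * (k i x - k i p) * gradProd g F (k i) x| := by congr 1; push_cast; ring
      _ ≤ _ := h3
      _ = _ := by ring

/-- A curve is an integral curve of `∇F` as soon as this holds when tested on smooth functions. -/
theorem hasMFDerivAt_of_forall {η : ℝ → Ω} {t : ℝ} (hη : ContinuousAt η t)
    (h : ∀ k : Ω → ℝ, (∀ᶠ z in 𝓝 (η t), SmoothAt n k z) →
      HasDerivAt (fun s => k (η s)) (gradProd g F k (η t)) t) :
    HasMFDerivAt 𝓘(ℝ, ℝ) (cornerModel n) η t
      ((1 : ℝ →L[ℝ] ℝ).smulRight (gradient g F (η t))) := by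
  refine ⟨hη, ?_⟩
  let φ := chartAt (EuclideanQuadrant (n + 1)) (η t)
  have hφ : IsSmoothChartAt φ (η t) :=
    ⟨IsManifold.chart_mem_maximalAtlas (η t), mem_chart_source _ (η t)⟩
  have hs : ∀ i, ∀ᶠ z in 𝓝 (η t), SmoothAt n (fun z => (φ z).1 i) z := fun i => by
    filter_upwards [φ.open_source.mem_nhds hφ.2] with z hz
    exact IsSmoothChartAt.smoothAt_coord ⟨hφ.1, hz⟩ i
  have hid : chartDifferential φ (η t) = ContinuousLinearMap.id ℝ _ :=
    mfderiv_extChartAt_self (I := cornerModel n) (x := η t)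
  let X : EuclideanSpace ℝ (Fin (n + 1)) := gradient g F (η t)
  have h1 : ∀ i, HasDerivAt (fun s => (φ (η s)).1 i) (X i) t := fun i => by
    have h2 : gradProd g F (fun z => (φ z).1 i) (η t) = X i :=
      gradProd_eq_differential.trans ((hφ.differential_coord i X).trans (by rw [hid]; rfl))
    rw [← h2]
    exact h _ (hs i)
  have h3 : HasDerivAt (fun s => (φ (η s)).1) X t := by
    have h4 := (PiLp.continuousLinearEquiv 2 ℝ
      (fun _ : Fin (n + 1) => ℝ)).symm.hasFDerivAt.comp_hasDerivAt t (hasDerivAt_pi.2 h1)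
    exact h4
  exact h3.hasFDerivAt.hasFDerivWithinAt

variable [T2Space Ω] [CompactSpace Ω]

/-- If `p` and `q` are the critical points of `F` and `p` is below `q`, then a trajectory of `∇F`
runs from `p` to `q`. -/
theorem Below.exists_mem_trajectorySet (hY : HasFaceCharts n Y) (hYc : IsClosed Y)
    (hF : ∀ x, AdaptedAt g Y F x) (hF0 : ∀ x, 0 ≤ F x) (hcrit : criticalSet n F = {p, q})
    (hpq : Below g Y F p q) (hne : p ≠ q) : ∃ x, x ∈ unstableSet g F p ∧ x ∈ stableSet g F q := by
  have hfin : (criticalSet n F).Finite := by rw [hcrit]; exact toFinite _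
  have hFs : ContMDiff (cornerModel n) 𝓘(ℝ, ℝ) ∞ F := fun x => (hF x).1
  obtain ⟨γ, hγ, hγp, hγq, hγF, hγle⟩ := hpq.exists_curve hY hYc hF hF0 hfin
  have hab : F p < F q := lt_of_le_of_ne (hpq F (isAscending_self hF))
    fun h => hne (hpq.eq_of_eq hY hYc hF hF0 hfin h)
  have hγc : ∀ s ∈ Ioo (F p) (F q), γ s ∉ criticalSet n F := by
    intro s hs hc
    rw [hcrit] at hc
    have h1 := hγF s (Ioo_subset_Icc_self hs)
    rcases hc with h | h
    · rw [h] at h1; exact hs.1.ne h1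
    · rw [mem_singleton_iff.1 h] at h1; exact hs.2.ne' h1
  have hder : ∀ s ∈ Ioo (F p) (F q), ∀ k : Ω → ℝ, (∀ᶠ z in 𝓝 (γ s), SmoothAt n k z) →
      HasDerivAt (fun t => k (γ t)) (gradProd g F k (γ s) / gradProd g F F (γ s)) s :=
    fun s hs k hk => hasDerivAt_comp_of_below hY hYc hF hF0 hγ
      (fun s hs => hγF s (Ioo_subset_Icc_self hs))
      (fun s hs t ht => hγle s (Ioo_subset_Icc_self hs) t (Ioo_subset_Icc_self ht)) hs (hγc s hs) hk
  let w : ℝ → ℝ := fun s => gradProd g F F (γ s)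
  have hw : ∀ s ∈ Ioo (F p) (F q), 0 < w s := fun s hs => gradProd_self_pos (hγc s hs)
  have hwc : Continuous w := (continuous_gradProd hF hF).comp hγ
  obtain ⟨R₀, C₀, hC₀, hR₀, h₀⟩ := exists_abs_gradProd_le (g := g) (p := p) hFs (by simp [hcrit])
  obtain ⟨R₁, C₁, hC₁, hR₁, h₁⟩ := exists_abs_gradProd_le (g := g) (p := q) hFs (by simp [hcrit])
  -- the estimates of `exists_abs_gradProd_le`, read along the curve
  have hend : ∀ {R : Ω → ℝ} {C c : ℝ} {l : Filter ℝ}, l ≤ 𝓝 c → γ c ∈ criticalSet n F →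
      R (γ c) = 0 → C ≤ C₀ + C₁ → (∀ᶠ s in l, s ∈ Ioo (F p) (F q)) →
      (∀ᶠ x in 𝓝 (γ c), SmoothAt n R x ∧ (x ≠ γ c → 0 < R x) ∧ |gradProd g F R x| ≤ C * R x) →
      (∀ᶠ s in l, 0 < R (γ s) ∧
        HasDerivAt (fun t => R (γ t)) (gradProd g F R (γ s) / gradProd g F F (γ s)) s ∧
        |gradProd g F R (γ s) / gradProd g F F (γ s)| * w s ≤ (C₀ + C₁) * R (γ s)) ∧
      Tendsto (fun t => R (γ t)) l (𝓝 0) := by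
    intro R C c l hl hc hR hCC hls h
    have hγl : Tendsto γ l (𝓝 (γ c)) := hγ.continuousAt.tendsto.mono_left hl
    constructor
    · filter_upwards [hls, hγl.eventually (eventually_eventually_nhds.2 h)] with s hs hsR
      obtain ⟨-, hpos, hle⟩ := hsR.self_of_nhds
      have hRpos := hpos fun heq => hγc s hs (heq ▸ hc)
      refine ⟨hRpos, hder s hs R (hsR.mono fun z hz => hz.1), ?_⟩
      rw [abs_div, abs_of_pos (hw s hs), div_mul_cancel₀ _ (hw s hs).ne']
      exact hle.trans (mul_le_mul_of_nonneg_right hCC hRpos.le)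
    · have := (ContMDiffAt.continuousAt h.self_of_nhds.1).tendsto.comp hγl
      rwa [hR] at this
  obtain ⟨hr₀, hr₀0⟩ := hend (R := R₀) (C := C₀) (c := F p) (l := 𝓝[>] (F p)) nhdsWithin_le_nhds
    (by simp [hγp, hcrit]) (by rw [hγp, hR₀]) (by linarith) (Ioo_mem_nhdsGT hab) (by rwa [hγp])
  obtain ⟨hr₁, hr₁0⟩ := hend (R := R₁) (C := C₁) (c := F q) (l := 𝓝[<] (F q)) nhdsWithin_le_nhds
    (by simp [hγq, hcrit]) (by rw [hγq, hR₁]) (by linarith) (Ioo_mem_nhdsLT hab) (by rwa [hγq])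
  obtain ⟨σ, hσ, hσq, hσp⟩ := exists_hasDerivAt_comp hab hw hwc.continuousOn (add_pos hC₀ hC₁)
    hr₀ hr₀0 hr₁ hr₁0
  have hη : ∀ t, HasMFDerivAt 𝓘(ℝ, ℝ) (cornerModel n) (fun t => γ (σ t)) t
      ((1 : ℝ →L[ℝ] ℝ).smulRight (gradient g F (γ (σ t)))) := by
    intro t
    refine hasMFDerivAt_of_forall (hγ.continuousAt.comp (hσ t).2.continuousAt) fun k hk => ?_
    have h2 := (hder (σ t) (hσ t).1 k hk).comp t (hσ t).2
    rwa [div_mul_cancel₀ _ (hw (σ t) (hσ t).1).ne'] at h2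
  refine ⟨γ (σ 0), ⟨fun t => γ (σ t), rfl, fun t _ => (hη t).hasMFDerivWithinAt, ?_⟩,
    ⟨fun t => γ (σ t), rfl, fun t _ => (hη t).hasMFDerivWithinAt, ?_⟩⟩
  · have := hγ.continuousAt.tendsto.comp hσp
    rwa [hγp] at this
  · have := hγ.continuousAt.tendsto.comp hσq
    rwa [hγq] at this

end Trajectory

/-! ### Rearrangement of the critical values -/

section Rearrangement

/-- There is an increasing function which has slope `1` near `a` and near `b` but varies arbitrarily
little on `[0, 1]`: its derivative is small outside of short intervals around `a` and `b`. -/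
theorem exists_contDiff_deriv_pos (a b : ℝ) {ε : ℝ} (hε : 0 < ε) (hε1 : ε ≤ 1) :
    ∃ κ : ℝ → ℝ, ContDiff ℝ ∞ κ ∧ κ 0 = 0 ∧ (∀ t, 0 < deriv κ t) ∧ κ 1 ≤ ε ∧
      (∀ᶠ t in 𝓝 a, κ t = t - (a - κ a)) ∧ ∀ᶠ t in 𝓝 b, κ t = t - (b - κ b) := by
  -- each of the two bumps contributes at most its width `2 * (ε / 6)` to the integral of `v`
  let u : ∀ c : ℝ, ContDiffBump c := fun c =>
    ⟨ε / 12, ε / 6, by positivity, by linarith⟩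
  let v : ℝ → ℝ := fun t => 1 - (1 - ε / 3) * ((1 - u a t) * (1 - u b t))
  have hv : ContDiff ℝ ∞ v := contDiff_const.sub (contDiff_const.mul
    ((contDiff_const.sub (u a).contDiff).mul (contDiff_const.sub (u b).contDiff)))
  have h01 : ∀ c t, 0 ≤ u c t ∧ u c t ≤ 1 := fun c t => ⟨(u c).nonneg, (u c).le_one⟩
  have hvpos : ∀ t, 0 < v t := fun t => by
    have h1 : (1 - u a t) * (1 - u b t) ≤ 1 :=
      mul_le_one₀ (by linarith [h01 a t]) (by linarith [h01 b t]) (by linarith [h01 b t])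
    have h2 : (1 - ε / 3) * ((1 - u a t) * (1 - u b t)) ≤ (1 - ε / 3) * 1 :=
      mul_le_mul_of_nonneg_left h1 (by linarith)
    simp only [v]
    linarith
  have hvle : ∀ t, v t ≤ ε / 3 + (u a t + u b t) := fun t => by
    have h1 := mul_nonneg (h01 a t).1 (h01 b t).1
    have h2 : 0 ≤ ε / 3 * (u a t + u b t - u a t * u b t) := mul_nonneg (by linarith) (by
      have := mul_le_of_le_one_right (h01 a t).1 (h01 b t).2
      linarith [h01 b t])
    simp only [v]
    linarith
  let κ : ℝ → ℝ := fun t => ∫ s in (0 : ℝ)..t, v s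
  have hκ : ∀ t, HasDerivAt κ (v t) t := fun t =>
    (hv.continuous.integral_hasStrictDerivAt 0 t).hasDerivAt
  have hκv : deriv κ = v := funext fun t => (hκ t).deriv
  have hloc : ∀ c, (∀ t ∈ Metric.ball c (ε / 12), v t = 1) → ∀ᶠ t in 𝓝 c, κ t = t - (c - κ c) := by
    intro c hc
    have hcc : c ∈ Metric.ball c (ε / 12) := Metric.mem_ball_self (by positivity)
    filter_upwards [Metric.isOpen_ball.mem_nhds hcc] with t ht
    have h1 := Metric.isOpen_ball.is_const_of_deriv_eq_zero (f := fun t => κ t - t)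
      (convex_ball c (ε / 12)).isPreconnected
      (fun s _ => ((hκ s).sub (hasDerivAt_id s)).differentiableAt.differentiableWithinAt)
      (fun s hs => by
        have h2 := ((hκ s).sub (hasDerivAt_id s)).deriv
        rw [hc s hs, sub_self] at h2
        exact h2) ht hcc
    linarith
  have hu1 : ∀ c, ∀ t ∈ Metric.ball c (ε / 12), u c t = 1 := fun c t ht =>
    (u c).one_of_mem_closedBall (Metric.ball_subset_closedBall ht)
  refine ⟨κ, contDiff_infty_iff_deriv.2 ⟨fun t => (hκ t).differentiableAt, hκv ▸ hv⟩,
    intervalIntegral.integral_same, fun t => hκv ▸ hvpos t, ?_,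
    hloc a fun t ht => by simp [v, hu1 a t ht], hloc b fun t ht => by simp [v, hu1 b t ht]⟩
  have hint : ∀ c, IntervalIntegrable (u c) MeasureTheory.volume 0 1 := fun c =>
    (u c).continuous.intervalIntegrable _ _
  have hule : ∀ c, ∫ t in (0 : ℝ)..1, u c t ≤ ε / 3 := fun c => by
    rw [intervalIntegral.integral_of_le zero_le_one]
    refine (MeasureTheory.setIntegral_le_integral (u c).integrable
      (Eventually.of_forall fun t => (u c).nonneg)).trans ?_
    refine ((u c).integral_le_measure_closedBall MeasureTheory.volume).trans ?_
    rw [Real.volume_real_closedBall (u c).rOut_pos.le]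
    exact le_of_eq (by change 2 * (ε / 6) = ε / 3; ring)
  calc κ 1 ≤ ∫ t in (0 : ℝ)..1, (ε / 3 + (u a t + u b t)) :=
        intervalIntegral.integral_mono_on zero_le_one (hv.continuous.intervalIntegrable _ _)
          (intervalIntegrable_const.add ((hint a).add (hint b))) fun t _ => hvle t
    _ = ε / 3 + ((∫ t in (0 : ℝ)..1, u a t) + ∫ t in (0 : ℝ)..1, u b t) := by
        rw [intervalIntegral.integral_add intervalIntegrable_const ((hint a).add (hint b)),
          intervalIntegral.integral_add (hint a) (hint b)]
        simp
    _ ≤ ε := by linarith [hule a, hule b]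

variable {n : ℕ} {Ω : Type*} [TopologicalSpace Ω] [ChartedSpace (EuclideanQuadrant (n + 1)) Ω]

/-- The Hessian, which is defined by a chart, depends only on the germ of the differential. -/
theorem hessian_eq_of_eventuallyEq_sub_const {F G : Ω → ℝ} {c : ℝ} {p : Ω}
    (h : G =ᶠ[𝓝 p] fun x => F x - c) : hessian n G p = hessian n F p := by
  have h1 : ∀ᶠ z in 𝓝 (extChartAt (cornerModel n) p p),
      G ((extChartAt (cornerModel n) p).symm z) =
        F ((extChartAt (cornerModel n) p).symm z) - c := by
    have h2 := continuousAt_extChartAt_symm (I := cornerModel n) p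
    rw [ContinuousAt, extChartAt_to_inv] at h2
    exact h2.eventually h
  refine EventuallyEq.fderivWithin_eq_of_nhds ?_
  filter_upwards [eventually_eventually_nhds.2 h1] with y hy
  rw [EventuallyEq.fderivWithin_eq_of_nhds hy, fderivWithin_sub_const]

variable [IsManifold (cornerModel n) ∞ Ω] {g : Metric n Ω} {Y S₀ S₁ : Set Ω} {F G : Ω → ℝ}
  {p q : Ω}

theorem mem_criticalSet_of_eventuallyEq_sub_const {c : ℝ} (hF : SmoothAt n F p)
    (hp : p ∈ criticalSet n F) (h : G =ᶠ[𝓝 p] fun x => F x - c) (g : Metric n Ω) :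
    p ∈ criticalSet n G := by
  by_contra hpG
  have h1 := gradProd_self_pos (g := g) hpG
  rw [gradProd_congr h, gradProd_sub_const c hF, gradProd_of_mem_criticalSet hp] at h1
  exact lt_irrefl _ h1

/-- Disjoint closed sets are separated by an ascending function if no point of the upper one lies
below a point of the lower one. -/
theorem exists_isAscending_separating (hY : HasFaceCharts n Y) {A B : Set Ω} (hA : IsCompact A)
    (hB : IsCompact B) (h : ∀ x ∈ B, ∀ z ∈ A, ¬ Below g Y F x z) :
    ∃ μ, IsAscending g Y F μ ∧ (∀ x, μ x ∈ Icc 0 1) ∧ (∀ z ∈ A, μ =ᶠ[𝓝 z] fun _ => 0) ∧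
      ∀ x ∈ B, μ =ᶠ[𝓝 x] fun _ => 1 := by
  choose! c hc hc0 hc1 hcA using fun x hx => exists_isAscending_eq_zero hY hA (h x hx)
  obtain ⟨t, htB, ht⟩ := hB.elim_nhds_subcover (fun x => {w | 1 / 2 < c x w}) fun x hx =>
    (hc x hx).continuous.continuousAt.eventually
      (lt_mem_nhds (by rw [hc1 x hx]; exact one_half_lt_one))
  have hs : IsAscending g Y F fun w => ∑ i ∈ t, c i w :=
    IsAscending.sum hY t fun i hi => hc i (htB i hi)
  refine ⟨fun w => Real.smoothTransition (2 * ∑ i ∈ t, c i w),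
    hs.comp hY (Real.smoothTransition.contDiff.comp (contDiff_const.mul contDiff_id))
      (Real.smoothTransition.monotone.comp fun a b hab => by simpa using hab),
    fun w => ⟨Real.smoothTransition.nonneg _, Real.smoothTransition.le_one _⟩, ?_, ?_⟩
  · intro z hz
    filter_upwards [(t.eventually_all).2 fun i hi => hcA i (htB i hi) z hz] with w hw
    rw [Finset.sum_eq_zero hw, mul_zero, Real.smoothTransition.zero]
  · intro x hx
    obtain ⟨i, hi, hxi⟩ := mem_iUnion₂.1 (ht hx)
    have h1 : 1 / 2 < ∑ i ∈ t, c i x := lt_of_lt_of_le hxi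
      (Finset.single_le_sum (f := fun i => c i x) (fun j hj => hc0 j (htB j hj) x) hi)
    filter_upwards [hs.continuous.continuousAt.eventually (lt_mem_nhds h1)] with w hw
    exact Real.smoothTransition.one_of_one_le (by linarith)

theorem IsMorseFunction.adaptedAt (hF : IsMorseFunction Y S₀ S₁ g F) (x : Ω) : AdaptedAt g Y F x :=
  ⟨hF.smooth x, hF.tangent x⟩

variable [T2Space Ω]

/-- The rearrangement of `F` for a prescribed order of the critical values. The function `G` is the
sum of a function `κ ∘ F` with small values and of multiples of three ascending step functions,
which raise respectively everything above `S₀`, above `p`, and above `q`. -/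
theorem exists_isMorseFunction_of_not_below (hΩ : IsCobordism n Y S₀ S₁)
    (hF : IsMorseFunction Y S₀ S₁ g F) (hcrit : criticalSet n F = {p, q})
    (hqp : ¬ Below g Y F q p) {a b : ℝ} (ha : 0 < a) (hb : b < 1)
    (hab : a < b ∨ a = b ∧ F q ≤ F p) :
    ∃ G, IsMorseFunction Y S₀ S₁ g G ∧ criticalSet n G = {p, q} ∧ G p = a ∧ G q = b ∧
      (∃ c, ∀ᶠ x in 𝓝 p, F x - G x = c) ∧ ∃ c, ∀ᶠ x in 𝓝 q, F x - G x = c := by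
  have : CompactSpace Ω := isCompact_univ_iff.1 hΩ.compact
  have hY := hΩ.hasFaceCharts
  have hFa := hF.adaptedAt
  have hF0 : ∀ x, 0 ≤ F x := fun x => (hF.mem_Icc x).1
  have hfin : (criticalSet n F).Finite := by rw [hcrit]; exact toFinite _
  have hFF := isAscending_self hFa
  -- `F` is strictly increasing for the order, and extremal on `S₀` and `S₁`
  have hS₀ : ∀ {x z}, x ∉ S₀ → z ∈ S₀ → ¬ Below g Y F x z := fun {x z} hx hz h => by
    have h1 := h F hFF
    rw [hF.eq_zero z hz] at h1
    have h2 := h.eq_of_eq hY hΩ.closed_Y hFa hF0 hfin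
      (by rw [hF.eq_zero z hz]; exact le_antisymm h1 (hF0 x))
    exact hx (h2 ▸ hz)
  have hS₁ : ∀ {x z}, x ∈ S₁ → z ∉ S₁ → ¬ Below g Y F x z := fun {x z} hx hz h => by
    have h1 := h F hFF
    rw [hF.eq_one x hx] at h1
    have h2 := h.eq_of_eq hY hΩ.closed_Y hFa hF0 hfin
      (by rw [hF.eq_one x hx]; exact le_antisymm h1 (hF.mem_Icc z).2)
    exact hz (h2 ▸ hx)
  have hp := hF.critical_notMem p (by simp [hcrit])
  have hq := hF.critical_notMem q (by simp [hcrit])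
  rw [mem_union, not_or] at hp hq
  have hS : ∀ {x}, x ∈ S₁ → x ∉ S₀ := fun hx hx' => hΩ.disjoint.notMem_of_mem_left hx' hx
  have hS₀c := hΩ.closed_S₀.isCompact
  have hS₁c := hΩ.closed_S₁.isCompact
  obtain ⟨μ₁, hμ₁, hμ₁I, hμ₁0, hμ₁1⟩ := exists_isAscending_separating (g := g) (F := F) hY
    (A := S₀) (B := {p, q} ∪ S₁) hS₀c ((toFinite _).isCompact.union hS₁c) (by
      rintro x ((rfl | rfl) | hx) z hz
      · exact hS₀ hp.1 hz
      · exact hS₀ hq.1 hz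
      · exact hS₀ (hS hx) hz)
  obtain ⟨μ₂, hμ₂, hμ₂I, hμ₂0, hμ₂1⟩ := exists_isAscending_separating (g := g) (F := F) hY
    (A := {p} ∪ S₀) (B := {q} ∪ S₁) (isCompact_singleton.union hS₀c)
    (isCompact_singleton.union hS₁c) (by
      rintro x (rfl | hx) z (rfl | hz)
      · exact hqp
      · exact hS₀ hq.1 hz
      · exact hS₁ hx hp.2
      · exact hS₀ (hS hx) hz)
  obtain ⟨μ₃, hμ₃, hμ₃I, hμ₃0, hμ₃1⟩ := exists_isAscending_separating (g := g) (F := F) hY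
    (A := {p, q} ∪ S₀) (B := S₁) ((toFinite _).isCompact.union hS₀c) hS₁c (by
      rintro x hx z ((rfl | rfl) | hz)
      · exact hS₁ hx hp.2
      · exact hS₁ hx hq.2
      · exact hS₀ (hS hx) hz)
  -- the smallness of `κ ∘ F` needed for the weights `w₁`, `w₂`, `w₃` to be non-negative
  obtain ⟨ε, hε0, hε1, hεa, hεb, hεab⟩ : ∃ ε : ℝ, 0 < ε ∧ ε ≤ 1 ∧ ε ≤ a ∧ ε ≤ 1 - b ∧
      (a < b → ε ≤ b - a) := by
    by_cases h : a < b
    · exact ⟨min (min 1 a) (min (1 - b) (b - a)),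
        lt_min (lt_min one_pos ha) (lt_min (by linarith) (by linarith)), by simp, by simp, by simp,
        by simp⟩
    · exact ⟨min (min 1 a) (1 - b), lt_min (lt_min one_pos ha) (by linarith), by simp, by simp,
        by simp, fun h' => absurd h' h⟩
  obtain ⟨κ, hκ, hκ0, hκ', hκ1, hκp, hκq⟩ := exists_contDiff_deriv_pos (F p) (F q) hε0 hε1
  have hκm : Monotone κ := (strictMono_of_deriv_pos hκ').monotone
  have hκF : ∀ x, 0 ≤ κ (F x) ∧ κ (F x) ≤ κ 1 := fun x =>
    ⟨hκ0 ▸ hκm (hF0 x), hκm (hF.mem_Icc x).2⟩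
  -- the weights which give `G` the values `a` at `p`, `b` at `q` and `1` on `S₁`
  obtain ⟨w₁, hw₁⟩ : ∃ w, w = a - κ (F p) := ⟨_, rfl⟩
  obtain ⟨w₂, hw₂⟩ : ∃ w, w = b - κ (F q) - (a - κ (F p)) := ⟨_, rfl⟩
  obtain ⟨w₃, hw₃⟩ : ∃ w, w = 1 - κ 1 - (b - κ (F q)) := ⟨_, rfl⟩
  have hw₁0 : 0 ≤ w₁ := by linarith [hκF p]
  have hw₂0 : 0 ≤ w₂ := by
    rcases hab with h | ⟨h, h'⟩
    · linarith [hκF p, hκF q, hεab h]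
    · linarith [hκm h']
  have hw₃0 : 0 ≤ w₃ := by linarith [hκF q]
  have hκFa := hFF.comp hY hκ hκm
  have hterm : ∀ {μ : Ω → ℝ} {w : ℝ}, IsAscending g Y F μ → 0 ≤ w →
      IsAscending g Y F fun x => w * μ x := fun hμ hw =>
    hμ.comp hY (contDiff_const.mul contDiff_id) fun s t hst => mul_le_mul_of_nonneg_left hst hw
  have hadd : ∀ {k l : Ω → ℝ}, IsAscending g Y F k → IsAscending g Y F l →
      IsAscending g Y F fun x => k x + l x := fun {k l} hk hl x =>
    ⟨(hk x).1.add hY (hl x).1, by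
      rw [gradProd_add (hk x).1.1 (hl x).1.1]
      exact add_nonneg (hk x).2 (hl x).2⟩
  have hsteps : IsAscending g Y F fun x => w₁ * μ₁ x + (w₂ * μ₂ x + w₃ * μ₃ x) :=
    hadd (hterm hμ₁ hw₁0) (hadd (hterm hμ₂ hw₂0) (hterm hμ₃ hw₃0))
  let G : Ω → ℝ := fun x => κ (F x) + (w₁ * μ₁ x + (w₂ * μ₂ x + w₃ * μ₃ x))
  have hG : IsAscending g Y F G := hadd hκFa hsteps
  have hGpos : ∀ x, x ∉ criticalSet n F → 0 < gradProd g F G x := fun x hx => by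
    rw [gradProd_add (hκFa x).1.1 (hsteps x).1.1, gradProd_comp (hκ.differentiable (by simp))
      (hF.smooth x)]
    exact add_pos_of_pos_of_nonneg (mul_pos (hκ' _) (gradProd_self_pos hx)) (hsteps x).2
  have hGp : G =ᶠ[𝓝 p] fun x => F x - (F p - a) := by
    filter_upwards [(hF.smooth p).continuousAt.eventually hκp, hμ₁1 p (by simp),
      hμ₂0 p (by simp), hμ₃0 p (by simp)] with x h h₁ h₂ h₃
    simp only [G, h, h₁, h₂, h₃]
    linarith
  have hGq : G =ᶠ[𝓝 q] fun x => F x - (F q - b) := by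
    filter_upwards [(hF.smooth q).continuousAt.eventually hκq, hμ₁1 q (by simp),
      hμ₂1 q (by simp), hμ₃0 q (by simp)] with x h h₁ h₂ h₃
    simp only [G, h, h₁, h₂, h₃]
    linarith
  have hGF : ∀ x ∈ criticalSet n F, ∃ c, G =ᶠ[𝓝 x] fun z => F z - c := by
    rw [hcrit]
    rintro x (rfl | rfl)
    exacts [⟨_, hGp⟩, ⟨_, hGq⟩]
  have hGcrit : criticalSet n G = criticalSet n F := by
    ext x
    constructor
    · intro hx
      by_contra hxF
      exact (hGpos x hxF).ne' (gradProd_of_mem_criticalSet hx)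
    · intro hx
      obtain ⟨c, hc⟩ := hGF x hx
      exact mem_criticalSet_of_eventuallyEq_sub_const (hF.smooth x) hx hc g
  refine ⟨G, ⟨fun x => (hG x).1.1, fun x => ⟨?_, ?_⟩, fun x hx => ?_, fun x hx => ?_, ?_, ?_,
    fun y => (hG y).1.2⟩, hGcrit.trans hcrit, ?_, ?_, ⟨F p - a, ?_⟩, ⟨F q - b, ?_⟩⟩
  · have h₁ := mul_nonneg hw₁0 (hμ₁I x).1
    have h₂ := mul_nonneg hw₂0 (hμ₂I x).1
    have h₃ := mul_nonneg hw₃0 (hμ₃I x).1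
    simp only [G]
    linarith [hκF x]
  · have h₁ := mul_le_of_le_one_right hw₁0 (hμ₁I x).2
    have h₂ := mul_le_of_le_one_right hw₂0 (hμ₂I x).2
    have h₃ := mul_le_of_le_one_right hw₃0 (hμ₃I x).2
    simp only [G]
    linarith [hκF x]
  · simp [G, hF.eq_zero x hx, hκ0, (hμ₁0 x hx).self_of_nhds,
      (hμ₂0 x (Or.inr hx)).self_of_nhds, (hμ₃0 x (Or.inr hx)).self_of_nhds]
  · simp only [G, hF.eq_one x hx, (hμ₁1 x (Or.inr hx)).self_of_nhds,
      (hμ₂1 x (Or.inr hx)).self_of_nhds, (hμ₃1 x hx).self_of_nhds]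
    linarith
  · intro x hx
    rw [hGcrit] at hx
    obtain ⟨c, hc⟩ := hGF x hx
    rw [IsNondegenerateAt, hessian_eq_of_eventuallyEq_sub_const hc]
    exact hF.nondegenerate x hx
  · rw [hGcrit]
    exact hF.critical_notMem
  · exact hGp.self_of_nhds.trans (sub_sub_cancel _ _)
  · exact hGq.self_of_nhds.trans (sub_sub_cancel _ _)
  · filter_upwards [hGp] with x hx
    rw [hx, sub_sub_cancel]
  · filter_upwards [hGq] with x hx
    rw [hx, sub_sub_cancel]

/-- If the trajectory sets of the critical points are disjoint, then the critical points are not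
comparable. -/
theorem not_below_of_disjoint_trajectorySet (hΩ : IsCobordism n Y S₀ S₁)
    (hF : IsMorseFunction Y S₀ S₁ g F) (hcrit : criticalSet n F = {p, q})
    (hK : Disjoint (trajectorySet g F p) (trajectorySet g F q)) : ¬ Below g Y F p q := by
  have : CompactSpace Ω := isCompact_univ_iff.1 hΩ.compact
  intro h
  have hne : p ≠ q := by
    rintro rfl
    exact hK.notMem_of_mem_left (Or.inl (Or.inr rfl)) (Or.inl (Or.inr rfl))
  obtain ⟨x, hxp, hxq⟩ := h.exists_mem_trajectorySet hΩ.hasFaceCharts hΩ.closed_Y hF.adaptedAt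
    (fun x => (hF.mem_Icc x).1) hcrit hne
  exact hK.notMem_of_mem_left (Or.inr hxp) (Or.inl (Or.inl hxq))

end Rearrangement

end CornerCobordism

theorem mainTheorem8 {n : ℕ} {Ω : Type*} [TopologicalSpace Ω] [T2Space Ω]
    [ChartedSpace (EuclideanQuadrant (n + 1)) Ω]
    [IsManifold (CornerCobordism.cornerModel n) ∞ Ω]
    (Y S₀ S₁ : Set Ω) (hΩ : CornerCobordism.IsCobordism n Y S₀ S₁)
    (g : CornerCobordism.Metric n Ω) (F : Ω → ℝ)
    (hF : CornerCobordism.IsMorseFunction Y S₀ S₁ g F)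
    (p₁ p₂ : Ω) (hcrit : CornerCobordism.criticalSet n F = {p₁, p₂})
    (hK : Disjoint (CornerCobordism.trajectorySet g F p₁)
      (CornerCobordism.trajectorySet g F p₂))
    (a₁ a₂ : ℝ) (ha₁ : a₁ ∈ Ioo (0 : ℝ) 1) (ha₂ : a₂ ∈ Ioo (0 : ℝ) 1) :
    ∃ (h : CornerCobordism.Metric n Ω) (G : Ω → ℝ),
      CornerCobordism.IsMorseFunction Y S₀ S₁ h G ∧
      CornerCobordism.criticalSet n G = {p₁, p₂} ∧
      G p₁ = a₁ ∧ G p₂ = a₂ ∧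
      (∃ c₁ : ℝ, ∀ᶠ x in 𝓝 p₁, F x - G x = c₁) ∧
      (∃ c₂ : ℝ, ∀ᶠ x in 𝓝 p₂, F x - G x = c₂) ∧
      (∃ U : Set Ω, IsOpen U ∧
        CornerCobordism.trajectorySet g F p₁ ∪ CornerCobordism.trajectorySet g F p₂ ⊆ U ∧
        ∀ x ∈ U, h.inner x = g.inner x) ∧
      (p₁ ∉ Y ∨ p₂ ∉ Y → ∀ x, h.inner x = g.inner x) := by
  have hcrit' := hcrit.trans (pair_comm p₁ p₂)
  have h₁₂ := CornerCobordism.not_below_of_disjoint_trajectorySet hΩ hF hcrit hK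
  have h₂₁ := CornerCobordism.not_below_of_disjoint_trajectorySet hΩ hF hcrit' hK.symm
  suffices h : ∃ G, CornerCobordism.IsMorseFunction Y S₀ S₁ g G ∧
      CornerCobordism.criticalSet n G = {p₁, p₂} ∧ G p₁ = a₁ ∧ G p₂ = a₂ ∧
      (∃ c₁, ∀ᶠ x in 𝓝 p₁, F x - G x = c₁) ∧ ∃ c₂, ∀ᶠ x in 𝓝 p₂, F x - G x = c₂ by
    obtain ⟨G, h1, h2, h3, h4, h5, h6⟩ := h
    exact ⟨g, G, h1, h2, h3, h4, h5, h6, ⟨univ, isOpen_univ, subset_univ _, fun _ _ => rfl⟩,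
      fun _ _ => rfl⟩
  by_cases hord : a₁ < a₂ ∨ a₁ = a₂ ∧ F p₂ ≤ F p₁
  · exact CornerCobordism.exists_isMorseFunction_of_not_below hΩ hF hcrit h₂₁ ha₁.1 ha₂.2 hord
  · have hord' : a₂ < a₁ ∨ a₂ = a₁ ∧ F p₁ ≤ F p₂ := by
      rcases lt_trichotomy a₁ a₂ with h | h | h
      · exact absurd (Or.inl h) hord
      · exact Or.inr ⟨h.symm, (not_le.1 fun h' => hord (Or.inr ⟨h, h'⟩)).le⟩
      · exact Or.inl h
    obtain ⟨G, h1, h2, h3, h4, h5, h6⟩ :=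
      CornerCobordism.exists_isMorseFunction_of_not_below hΩ hF hcrit' h₁₂ ha₂.1 ha₁.2 hord'
    exact ⟨G, h1, h2.trans (pair_comm p₂ p₁), h4, h3, h6, h5⟩
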